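/- Let $T>0$ and $\kappa>0$, and let $f:\mathbb R\to(-\infty,+\infty]$ be either $f(y)=-\ln y$ for $y>0$, or $f(y)=y^{-\alpha}$ for $y>0$ with some $\alpha>0$; in both cases $f(y)=+\infty$ for $y\le 0$. Consider on $[0,T]\times[0,1]$ the reflected stochastic Cahn–Hilliard equation $$\partial_t X=-\kappa\,\Delta\big(\Delta X+f(X)+\eta\big)+\partial_\theta\dot W,\qquad \partial_\theta X=\partial_\theta^3 X=0\ \text{ at }\theta\in\{0,1\},\qquad X\ge 0,\quad \int X\,d\eta=0, \tag{E}$$ where $\dot W$ is space–time white noise (the standard normalization is $\kappa=\tfrac12$). Notation: $\langle\cdot,\cdot\rangle$ is the $L^2(0,1)$ scalar product (also used for the $L^\infty$–$L^1$ duality); $\bar h=\int_0^1h$; $A=\partial_\theta^2$ with domain $D(A)=\{h\in W^{2,2}(0,1):h'(0)=h'(1)=0\}$; $D(A^2)=\{h\in D(A): Ah\in D(A)\}$; $e_i(\theta)=\sqrt2\cos(i\pi\theta)$; $V_{-1}$ is the completion of $L^2(0,1)$ for the norm $\|h\|_{-1}^2=\sum_{i\ge1}(i\pi)^{-2}\langle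 h,e_i\rangle^2+\bar h^2$; $O_{s,t}=[s,t]\times[0,1]$. For $x\in C([0,1];[0,\infty))$ with $\bar x>0$, a triple $(X,\eta,W)$ on a complete probability space $(\Omega,\mathcal F,\mathbb P)$ with a complete filtration $(\mathcal F_t)_{t\in[0,T]}$ is a *weak solution* of (E) on $[0,T]$ with initial datum $x$ if (a) a.s. $X\in C((0,T]\times[0,1];[0,\infty))\cap C([0,T];V_{-1})$ and $X(0)=x$; (b) a.s. $\eta$ is a positive measure on $(0,T]\times[0,1]$ with $\eta(O_{\delta,T})<\infty$ for all $\delta\in(0,T]$; (c) $W$ is a cylindrical Wiener process on $L^2(0,1)$ with respect to $(\mathcal F_t)$; (d) $(X,W)$ is $(\mathcal F_t)$-adapted; (e) a.s. $f(X)\in L^1(O_{0,T})$; (f) for all $h\in D(A^2)$ and all $0<\delta\le t\le T$, a.s. $$\langle X(t),h\rangle=\langle X(\delta),h\rangle-\kappa\int_\delta^t\langle X(s),A^2h\rangle\,ds-\kappa\int_\delta^t\langle Ah,f(X(s))\rangle\,ds-\kappa\int_{O_{\delta,t}}Ah(\theta)\,\eta(ds,d\theta)-\int_\delta^t\langle h',dW_s\rangle;$$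 (g) a.s. $\int_{O_{0,T}}X\,d\eta=0$. **Pathwise uniqueness.** Let $x\in C([0,1];[0,\infty))$ with $\bar x>0$, and let $(X^1,\eta^1,W)$ and $(X^2,\eta^2,W)$ be two weak solutions of (E) on $[0,T]$ with initial datum $x$, defined on the same probability space (possibly with different filtrations) with the same noise $W$. Then, almost surely, $X^1(t,\theta)=X^2(t,\theta)$ for all $(t,\theta)\in[0,T]\times[0,1]$, and $\eta^1=\eta^2$. -/

import Mathlib

open MeasureTheory ProbabilityTheory Set Filter Topology
open scoped ENNReal

namespace CahnHilliard

/-! ### The nonlinearity -/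

/-- `f(x) = -ln x` for `x > 0`, and `f(x) = +∞` for `x ≤ 0`. -/
noncomputable def fLog (x : ℝ) : EReal :=
  if 0 < x then ((-Real.log x : ℝ) : EReal) else ⊤

/-- `f(x) = x ^ (-α)` for `x > 0`, and `f(x) = +∞` for `x ≤ 0`. -/
noncomputable def fPow (α : ℝ) (x : ℝ) : EReal :=
  if 0 < x then ((x ^ (-α) : ℝ) : EReal) else ⊤

/-- The admissible nonlinearities: the logarithm, or a negative power. -/
def IsAdmissibleNonlinearity (f : ℝ → EReal) : Prop :=
  f = fLog ∨ ∃ α : ℝ, 0 < α ∧ f = fPow α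

/-! ### Function spaces on `(0,1)` -/

/-- Lebesgue measure on `[0,1]`. -/
noncomputable abbrev leb01 : Measure ℝ := volume.restrict (Icc 0 1)

/-- The Hilbert space `L²(0,1)`. -/
abbrev L2 : Type := Lp ℝ 2 leb01

/-- `v` is the weak derivative of `u` on `(0,1)`: integration by parts against smooth test functions
with compact support in `(0,1)`. -/
def IsWeakDeriv (u v : ℝ → ℝ) : Prop :=
  ∀ φ : ℝ → ℝ, ContDiff ℝ ((⊤ : ℕ∞) : WithTop ℕ∞) φ → HasCompactSupport φ → tsupport φ ⊆ Ioo 0 1 →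
    ∫ θ in (0 : ℝ)..1, u θ * deriv φ θ = -∫ θ in (0 : ℝ)..1, v θ * φ θ

/-- `h ∈ D(A)` and `A h = g`, where `A` is the Neumann Laplacian on `L²(0,1)`, with domain
`{h ∈ W^{2,2}(0,1) : ∂h(0) = ∂h(1) = 0}`. The functions `h` and `h₁` are the continuous
representatives on `[0,1]` of the element of `W^{2,2}(0,1)` and of its first weak derivative; `g` is
its second weak derivative. -/
structure IsNeumannLaplacian (h h₁ g : ℝ → ℝ) : Prop where
  continuousOn : ContinuousOn h (Icc 0 1)
  continuousOn_deriv : ContinuousOn h₁ (Icc 0 1)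
  memLp : MemLp g 2 leb01
  weakDeriv : IsWeakDeriv h h₁
  weakDeriv_deriv : IsWeakDeriv h₁ g
  deriv_zero : h₁ 0 = 0
  deriv_one : h₁ 1 = 0

theorem memLp_of_continuousOn {h : ℝ → ℝ} (hh : ContinuousOn h (Icc 0 1)) :
    MemLp h 2 leb01 := by
  obtain ⟨C, hC⟩ := isCompact_Icc.exists_bound_of_continuousOn hh
  exact MemLp.of_bound (hh.aestronglyMeasurable measurableSet_Icc) C
    (ae_restrict_of_forall_mem measurableSet_Icc hC)

/-- The first derivative of an element of `D(A)`, as an element of `L²(0,1)`. -/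
noncomputable def IsNeumannLaplacian.derivL2 {h h₁ g : ℝ → ℝ} (H : IsNeumannLaplacian h h₁ g) :
    L2 :=
  (memLp_of_continuousOn H.continuousOn_deriv).toLp h₁

/-- The mean `∫₀¹ h`. -/
noncomputable def mean (h : ℝ → ℝ) : ℝ := ∫ θ in (0 : ℝ)..1, h θ

/-- The coefficient `⟨h, e_i⟩`, where `e_i(θ) = √2 cos(iπθ)`, for `i ≥ 1`. -/
noncomputable def cosCoeff (h : ℝ → ℝ) (i : ℕ) : ℝ :=
  ∫ θ in (0 : ℝ)..1, h θ * (√2 * Real.cos (i * Real.pi * θ))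

/-- The norm of `V_{-1}` on functions of `L²(0,1)`:
`‖h‖² = ∑_{i ≥ 1} (iπ)^{-2} ⟨h, e_i⟩² + (mean h)²`. -/
noncomputable def normVNegOne (h : ℝ → ℝ) : ℝ :=
  √((∑' i : ℕ, (((i + 1 : ℕ) * Real.pi) ^ 2)⁻¹ * cosCoeff h (i + 1) ^ 2) + mean h ^ 2)

/-- The path `u` belongs to `C([0,T]; V_{-1})` (for a path whose values lie in `L²(0,1)`). -/
def ContinuousInVNegOne (T : ℝ) (u : ℝ → ℝ → ℝ) : Prop :=
  ∀ s ∈ Icc 0 T,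
    Tendsto (fun t => normVNegOne (fun θ => u t θ - u s θ)) (𝓝[Icc 0 T] s) (𝓝 0)

/-! ### The noise -/

section Probability

variable {Ω : Type*} [mΩ : MeasurableSpace Ω]

/-- `W` is a cylindrical Wiener process on `L²(0,1)` over `[0,T]` with respect to the filtration `𝓕`:
a family `W t φ` (formally `⟨W_t, φ⟩`) which is linear in `φ`, adapted, starts at `0`, has continuous
paths in `t`, and whose increment over `[s,t]` is independent of `𝓕 s` with law
`N(0, (t - s) ‖φ‖²)`. -/
structure IsCylindricalWiener (P : Measure Ω) (T : ℝ) (𝓕 : Filtration (Icc (0 : ℝ) T) mΩ)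
    (W : ℝ → L2 → Ω → ℝ) : Prop where
  adapted : ∀ (t : Icc (0 : ℝ) T) (φ : L2), Measurable[𝓕 t] (W t φ)
  start_zero : ∀ φ : L2, ∀ᵐ ω ∂P, W 0 φ ω = 0
  linear : ∀ t ∈ Icc 0 T, ∀ (a b : ℝ) (φ ψ : L2),
    ∀ᵐ ω ∂P, W t (a • φ + b • ψ) ω = a * W t φ ω + b * W t ψ ω
  continuous_paths : ∀ φ : L2, ∀ᵐ ω ∂P, ContinuousOn (fun t => W t φ ω) (Icc 0 T)
  increment_law : ∀ s t : Icc (0 : ℝ) T, s ≤ t → ∀ φ : L2,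
    P.map (fun ω => W t φ ω - W s φ ω) =
      gaussianReal 0 (((t : ℝ) - s) * ‖φ‖ ^ 2).toNNReal
  increment_indep : ∀ s t : Icc (0 : ℝ) T, s ≤ t → ∀ φ : L2,
    Indep (𝓕 s) (MeasurableSpace.comap (fun ω => W t φ ω - W s φ ω) inferInstance) P

/-! ### Weak solutions -/

/-- `(X, η, W)` is a weak solution on `[0,T]`, with initial condition `x`, of the reflected equation
`∂ₜX = -κ Δ(ΔX + f(X) + η) + ∂_θ Ẇ` with Neumann boundary conditions, `X ≥ 0` and `∫ X dη = 0`, on the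
filtered complete probability space `(Ω, P, 𝓕)`.

The process is `X t θ ω`, for `(t, θ) ∈ [0,T] × [0,1]`. A measure on `(0,T] × [0,1]` is viewed as a
measure on the plane that is carried by this set. -/
structure IsWeakSolution (κ : ℝ) (f : ℝ → EReal) (T : ℝ) (x : ℝ → ℝ) (P : Measure Ω)
    (𝓕 : Filtration (Icc (0 : ℝ) T) mΩ) (X : ℝ → ℝ → Ω → ℝ) (η : Ω → Measure (ℝ × ℝ))
    (W : ℝ → L2 → Ω → ℝ) : Prop where
  /-- the filtration is complete -/
  complete : ∀ (t : Icc (0 : ℝ) T) (N : Set Ω), P N = 0 → MeasurableSet[𝓕 t] N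
  /-- continuity on `(0,T] × [0,1]` -/
  continuousOn : ∀ᵐ ω ∂P, ContinuousOn (fun p : ℝ × ℝ => X p.1 p.2 ω) (Ioc 0 T ×ˢ Icc 0 1)
  nonneg : ∀ᵐ ω ∂P, ∀ t ∈ Ioc 0 T, ∀ θ ∈ Icc (0 : ℝ) 1, 0 ≤ X t θ ω
  /-- continuity on `[0,T]` with values in `V_{-1}` -/
  continuous_VNegOne : ∀ᵐ ω ∂P, ContinuousInVNegOne T (fun t θ => X t θ ω)
  initial : ∀ᵐ ω ∂P, ∀ θ ∈ Icc (0 : ℝ) 1, X 0 θ ω = x θ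
  /-- `η` is a measure on `(0,T] × [0,1]` -/
  carrier : ∀ᵐ ω ∂P, η ω (Ioc 0 T ×ˢ Icc 0 1)ᶜ = 0
  finite : ∀ᵐ ω ∂P, ∀ δ ∈ Ioc 0 T, η ω (Icc δ T ×ˢ Icc 0 1) < ∞
  wiener : IsCylindricalWiener P T 𝓕 W
  /-- `X` is adapted (adaptedness of `W` is part of `wiener`) -/
  adapted : ∀ t : Icc (0 : ℝ) T, ∀ θ ∈ Icc (0 : ℝ) 1, Measurable[𝓕 t] (X t θ)
  /-- `f(X) ∈ L¹([0,T] × [0,1])`; in particular `f(X)` is finite almost everywhere -/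
  integrable : ∀ᵐ ω ∂P,
    (∀ᵐ p : ℝ × ℝ ∂(volume.restrict (Icc 0 T ×ˢ Icc 0 1)), f (X p.1 p.2 ω) ≠ ⊤) ∧
    IntegrableOn (fun p : ℝ × ℝ => (f (X p.1 p.2 ω)).toReal) (Icc 0 T ×ˢ Icc 0 1)
  /-- the weak form of the equation, tested against `h ∈ D(A²)` with `A h = g` and `A² h = k`; the
  stochastic integral of the constant integrand `∂h` over `[δ,t]` is the increment
  `W_t(∂h) - W_δ(∂h)` -/
  equation : ∀ (h h₁ g g₁ k : ℝ → ℝ) (Hh : IsNeumannLaplacian h h₁ g),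
    IsNeumannLaplacian g g₁ k → ∀ δ t : ℝ, 0 < δ → δ ≤ t → t ≤ T → ∀ᵐ ω ∂P,
      ∫ θ in (0 : ℝ)..1, X t θ ω * h θ =
        (∫ θ in (0 : ℝ)..1, X δ θ ω * h θ)
        - κ * (∫ s in δ..t, ∫ θ in (0 : ℝ)..1, X s θ ω * k θ)
        - κ * (∫ s in δ..t, ∫ θ in (0 : ℝ)..1, g θ * (f (X s θ ω)).toReal)
        - κ * (∫ p in Icc δ t ×ˢ Icc 0 1, g p.2 ∂(η ω))
        - (W t Hh.derivL2 ω - W δ Hh.derivL2 ω)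
  /-- the contact condition -/
  contact : ∀ᵐ ω ∂P,
    ∫⁻ p in Icc 0 T ×ˢ Icc 0 1, ENNReal.ofReal (X p.1 p.2 ω) ∂(η ω) = 0

end Probability

end CahnHilliard

namespace CahnHilliard

/-! ### Fejér summation of cosine series -/

/-! Let `Z` be the difference of the two solutions. The noise is additive, so it cancels in the
equation for `Z`, and the rest is a deterministic energy estimate in `V_{-1}` for almost every path.
Formally, d‖Z‖²_{-1} = 2κ (-‖∂Z‖² dt + ⟨Z, f(X¹) - f(X²)⟩ dt + ∫ Z dη¹ - ∫ Z dη²). The second term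
is nonpositive because `f` is decreasing. The last two are nonpositive because `η¹` lives where `X¹
= 0`, hence `Z = -X² ≤ 0`, and symmetrically for `η²`. The mean of `Z` vanishes by mass
conservation, and `‖Z(a)‖_{-1} → 0` as `a → 0`, so `Z = 0`.

To make this rigorous, the equation is tested against cosines. Each coefficient of `Z` is continuous
with increments given by integrals against `dt dθ`, `η¹` and `η²`, so its square obeys the ordinary
chain rule (`sq_sub_sq_eq_sum_setIntegral`). Dividing by `(kπ)²` and dropping the dissipation leaves
terms to be summed over `k`. Since `Z` is only continuous and the `ηⁱ` are only measures, plain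
partial sums of its cosine series are not controlled. Fejér weights are: the kernel is positive of
mass one, so the means of `Z` are bounded and converge pointwise (`tendsto_fejerSum`), and dominated
convergence recovers the signed terms above (`inv_mul_cosIntegral_sq_le`). Letting the initial time
tend to `0` gives `IsPathSolution.cosIntegral_sub_eq_zero`.

Once `X¹ = X²`, the equation shows that `η¹` and `η²` have the same integrals against `cos (kπθ)`,
`k ≥ 1`, on time strips; only the total mass of a strip is undetermined. Since the mean of `X` is
positive, near every time there is a space interval where `X > 0`, which neither measure charges. A
bump function on this interval fixes the missing mass (`measure_eq_of_cos`).

The equation holds almost surely only for each fixed pair of times, so everything is done at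
rational multiples of `T` and extended by continuity. -/

/-- The integral of `g` on `[0,1]` against `cos (kπ·)`. -/
noncomputable def cosIntegral (k : ℕ) (g : ℝ → ℝ) : ℝ :=
  ∫ y in (0 : ℝ)..1, g y * Real.cos (k * Real.pi * y)

/-- The weights of the Fejér means of a cosine series. -/
noncomputable def fejerWeight (N k : ℕ) : ℝ := if k = 0 then 1 else 2 * (1 - k / N)

/-- The Fejér kernel for cosine series on `[0,1]`. -/
noncomputable def fejerKernel (N : ℕ) (θ y : ℝ) : ℝ :=
  ∑ k ∈ Finset.range N,
    fejerWeight N k * Real.cos (k * Real.pi * θ) * Real.cos (k * Real.pi * y)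

/-- The Fejér means of the cosine series of `g`. -/
noncomputable def fejerSum (N : ℕ) (g : ℝ → ℝ) (θ : ℝ) : ℝ :=
  ∑ k ∈ Finset.range N, fejerWeight N k * cosIntegral k g * Real.cos (k * Real.pi * θ)

theorem fejerWeight_nonneg {N k : ℕ} (hk : k < N) : 0 ≤ fejerWeight N k := by
  unfold fejerWeight
  split_ifs
  · exact zero_le_one
  · have hN : (0 : ℝ) < N := by exact_mod_cast (Nat.zero_le k).trans_lt hk
    have : (k : ℝ) / N ≤ 1 := (div_le_one hN).2 (by exact_mod_cast hk.le)
    linarith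

theorem fejerWeight_le_two (N k : ℕ) : fejerWeight N k ≤ 2 := by
  unfold fejerWeight
  split_ifs
  · norm_num
  · have : (0 : ℝ) ≤ k / N := by positivity
    linarith

theorem tendsto_fejerWeight {k : ℕ} (hk : k ≠ 0) :
    Tendsto (fun N => fejerWeight N k) atTop (𝓝 2) := by
  have h := (tendsto_const_div_atTop_nhds_zero_nat (k : ℝ)).const_sub 1 |>.const_mul 2
  simpa [fejerWeight, hk] using h

/-- This is the expansion of |∑ exp(ijx)|² over `j < N`, in real form. Passing from `N` to `N + 1`
adds one diagonal term and twice the cosines of the differences `N - j`. -/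
theorem sum_fejer_eq_sq (x : ℝ) (N : ℕ) :
    ∑ k ∈ Finset.range N, (if k = 0 then (N : ℝ) else 2 * (N - k)) * Real.cos (k * x) =
      (∑ j ∈ Finset.range N, Real.cos (j * x)) ^ 2 +
        (∑ j ∈ Finset.range N, Real.sin (j * x)) ^ 2 := by
  induction N with
  | zero => simp
  | succ N ih =>
    have h1 : ∑ k ∈ Finset.range (N + 1),
        (if k = 0 then ((N + 1 : ℕ) : ℝ) else 2 * ((N + 1 : ℕ) - k)) * Real.cos (k * x) =
        ∑ k ∈ Finset.range (N + 1), (if k = 0 then (N : ℝ) else 2 * (N - k)) * Real.cos (k * x) +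
        ∑ k ∈ Finset.range (N + 1), (if k = 0 then (1 : ℝ) else 2) * Real.cos (k * x) := by
      rw [← Finset.sum_add_distrib]
      refine Finset.sum_congr rfl fun k _ => ?_
      split_ifs <;> push_cast <;> ring
    have h2 : ∑ k ∈ Finset.range (N + 1),
        (if k = 0 then (N : ℝ) else 2 * (N - k)) * Real.cos (k * x) =
        ∑ k ∈ Finset.range N, (if k = 0 then (N : ℝ) else 2 * (N - k)) * Real.cos (k * x) := by
      rw [Finset.sum_range_succ]
      rcases Nat.eq_zero_or_pos N with rfl | hN
      · simp
      · simp [hN.ne']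
    have h3 : ∑ k ∈ Finset.range (N + 1), (if k = 0 then (1 : ℝ) else 2) * Real.cos (k * x) =
        2 * ∑ k ∈ Finset.range N, Real.cos ((k + 1 : ℕ) * x) + 1 := by
      rw [Finset.sum_range_succ', Finset.mul_sum]
      simp
    have h4 : ∑ j ∈ Finset.range N,
        (Real.cos (j * x) * Real.cos (N * x) + Real.sin (j * x) * Real.sin (N * x)) =
        ∑ k ∈ Finset.range N, Real.cos ((k + 1 : ℕ) * x) := by
      rw [← Finset.sum_range_reflect (fun k => Real.cos ((k + 1 : ℕ) * x))]
      refine Finset.sum_congr rfl fun j hj => ?_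
      have hj : j < N := Finset.mem_range.1 hj
      have : ((N - 1 - j + 1 : ℕ) : ℝ) = N - j := by
        rw [show N - 1 - j + 1 = N - j by omega, Nat.cast_sub hj.le]
      rw [this, sub_mul, Real.cos_sub]
      ring
    rw [h1, h2, h3, ih, ← h4, Finset.sum_add_distrib, ← Finset.sum_mul, ← Finset.sum_mul,
      Finset.sum_range_succ, Finset.sum_range_succ]
    linear_combination -(Real.sin_sq_add_cos_sq (N * x))

theorem sum_fejerWeight_mul_cos_nonneg (N : ℕ) (x : ℝ) :
    0 ≤ ∑ k ∈ Finset.range N, fejerWeight N k * Real.cos (k * x) := by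
  rcases Nat.eq_zero_or_pos N with rfl | hN
  · simp
  have hN' : (0 : ℝ) < N := by exact_mod_cast hN
  have h : (N : ℝ) * ∑ k ∈ Finset.range N, fejerWeight N k * Real.cos (k * x) =
      ∑ k ∈ Finset.range N, (if k = 0 then (N : ℝ) else 2 * (N - k)) * Real.cos (k * x) := by
    rw [Finset.mul_sum]
    refine Finset.sum_congr rfl fun k _ => ?_
    unfold fejerWeight
    split_ifs
    · ring
    · field_simp
  refine nonneg_of_mul_nonneg_right ?_ hN'
  rw [h, sum_fejer_eq_sq]
  positivity

/-- Product-to-sum formulas turn the kernel into the average of the classical Fejér kernel at `π(θ -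
y)` and `π(θ + y)`, the effect of extending functions evenly. -/
theorem fejerKernel_nonneg (N : ℕ) (θ y : ℝ) : 0 ≤ fejerKernel N θ y := by
  have h : fejerKernel N θ y =
      ((∑ k ∈ Finset.range N, fejerWeight N k * Real.cos (k * (Real.pi * (θ - y)))) +
        ∑ k ∈ Finset.range N, fejerWeight N k * Real.cos (k * (Real.pi * (θ + y)))) / 2 := by
    rw [← Finset.sum_add_distrib, Finset.sum_div]
    refine Finset.sum_congr rfl fun k _ => ?_
    rw [show k * (Real.pi * (θ - y)) = k * Real.pi * θ - k * Real.pi * y by ring,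
      show k * (Real.pi * (θ + y)) = k * Real.pi * θ + k * Real.pi * y by ring,
      Real.cos_sub, Real.cos_add]
    ring
  rw [h]
  have h1 := sum_fejerWeight_mul_cos_nonneg N (Real.pi * (θ - y))
  have h2 := sum_fejerWeight_mul_cos_nonneg N (Real.pi * (θ + y))
  positivity

theorem continuous_fejerKernel (N : ℕ) (θ : ℝ) : Continuous (fejerKernel N θ) := by
  unfold fejerKernel
  fun_prop

theorem integral_cos_int_mul_pi (n : ℤ) :
    ∫ y in (0 : ℝ)..1, Real.cos (n * Real.pi * y) = if n = 0 then 1 else 0 := by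
  split_ifs with h
  · simp [h]
  · have hn : (n : ℝ) * Real.pi ≠ 0 := mul_ne_zero (by exact_mod_cast h) Real.pi_ne_zero
    rw [intervalIntegral.integral_comp_mul_left _ hn]
    simp [Real.sin_int_mul_pi]

theorem cosIntegral_cos (k m : ℕ) :
    cosIntegral k (fun y => Real.cos (m * Real.pi * y)) =
      if k = m then (if m = 0 then 1 else 1 / 2) else 0 := by
  have h : ∀ y : ℝ, Real.cos (m * Real.pi * y) * Real.cos (k * Real.pi * y) =
      (1 / 2) * Real.cos (((m - k : ℤ) : ℝ) * Real.pi * y) +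
        (1 / 2) * Real.cos (((m + k : ℤ) : ℝ) * Real.pi * y) := by
    intro y
    push_cast
    rw [show ((m : ℝ) - k) * Real.pi * y = m * Real.pi * y - k * Real.pi * y by ring,
      show ((m : ℝ) + k) * Real.pi * y = m * Real.pi * y + k * Real.pi * y by ring,
      Real.cos_sub, Real.cos_add]
    ring
  unfold cosIntegral
  simp_rw [h]
  rw [intervalIntegral.integral_add (Continuous.intervalIntegrable (by fun_prop) _ _)
    (Continuous.intervalIntegrable (by fun_prop) _ _),
    intervalIntegral.integral_const_mul, intervalIntegral.integral_const_mul,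
    integral_cos_int_mul_pi, integral_cos_int_mul_pi]
  by_cases hkm : k = m
  · subst hkm
    by_cases hk : k = 0
    · simp [hk]; norm_num
    · have : (k : ℤ) + k ≠ 0 := by omega
      simp [hk]
  · have h1 : (m : ℤ) - k ≠ 0 := by omega
    have h2 : (m : ℤ) + k ≠ 0 := by omega
    simp [hkm, h1, h2]

theorem fejerSum_cos {N m : ℕ} (hm : m < N) (θ : ℝ) :
    fejerSum N (fun y => Real.cos (m * Real.pi * y)) θ =
      (1 - m / N) * Real.cos (m * Real.pi * θ) := by
  unfold fejerSum
  simp_rw [cosIntegral_cos]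
  rw [Finset.sum_eq_single m]
  · unfold fejerWeight
    by_cases h : m = 0
    · simp [h]
    · rw [if_neg h, if_pos rfl, if_neg h]
      ring
  · intro k _ hk
    simp [hk]
  · intro h
    exact absurd (Finset.mem_range.2 hm) h

theorem fejerSum_eq_integral {g : ℝ → ℝ} (hg : ContinuousOn g (Icc 0 1)) (N : ℕ) (θ : ℝ) :
    fejerSum N g θ = ∫ y in (0 : ℝ)..1, fejerKernel N θ y * g y := by
  unfold fejerSum fejerKernel cosIntegral
  simp_rw [Finset.sum_mul]
  rw [intervalIntegral.integral_finsetSum]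
  · refine Finset.sum_congr rfl fun k _ => ?_
    rw [mul_right_comm, ← intervalIntegral.integral_const_mul]
    refine intervalIntegral.integral_congr fun y _ => ?_
    ring
  · intro k _
    refine ContinuousOn.intervalIntegrable ?_
    rw [uIcc_of_le zero_le_one]
    fun_prop

theorem intervalIntegrable_fejerKernel_mul {g : ℝ → ℝ} (hg : ContinuousOn g (Icc 0 1)) (N : ℕ)
    (θ : ℝ) : IntervalIntegrable (fun y => fejerKernel N θ y * g y) volume 0 1 := by
  refine ContinuousOn.intervalIntegrable ?_
  rw [uIcc_of_le zero_le_one]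
  exact (continuous_fejerKernel N θ).continuousOn.mul hg

theorem integral_fejerKernel {N : ℕ} (hN : 0 < N) (θ : ℝ) :
    ∫ y in (0 : ℝ)..1, fejerKernel N θ y = 1 := by
  have h := fejerSum_eq_integral (g := fun y => Real.cos ((0 : ℕ) * Real.pi * y))
    (by fun_prop) N θ
  rw [fejerSum_cos hN] at h
  simpa using h.symm

/-- A Fejér mean is an average against a probability density, so pointwise bounds pass through it.
Both the uniform bound and the convergence of the means come from this. -/
theorem abs_fejerSum_sub_le {g b : ℝ → ℝ} (hg : ContinuousOn g (Icc 0 1))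
    (hb : ContinuousOn b (Icc 0 1)) {N : ℕ} (hN : 0 < N) (c θ : ℝ)
    (h : ∀ y ∈ Icc (0 : ℝ) 1, |g y - c| ≤ b y) :
    |fejerSum N g θ - c| ≤ fejerSum N b θ := by
  have hc : c = ∫ y in (0 : ℝ)..1, fejerKernel N θ y * c := by
    rw [intervalIntegral.integral_mul_const, integral_fejerKernel hN, one_mul]
  have h1 : fejerSum N g θ - c = ∫ y in (0 : ℝ)..1, fejerKernel N θ y * (g y - c) := by
    conv_lhs => rw [hc]
    rw [fejerSum_eq_integral hg, ← intervalIntegral.integral_sub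
      (intervalIntegrable_fejerKernel_mul hg N θ)
      (intervalIntegrable_fejerKernel_mul continuousOn_const N θ)]
    simp_rw [mul_sub]
  rw [h1, fejerSum_eq_integral hb]
  refine (intervalIntegral.abs_integral_le_integral_abs zero_le_one).trans ?_
  refine intervalIntegral.integral_mono_on zero_le_one
    (intervalIntegrable_fejerKernel_mul (hg.sub continuousOn_const) N θ).abs
    (intervalIntegrable_fejerKernel_mul hb N θ) fun y hy => ?_
  rw [abs_mul, abs_of_nonneg (fejerKernel_nonneg N θ y)]
  exact mul_le_mul_of_nonneg_left (h y hy) (fejerKernel_nonneg N θ y)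

theorem fejerSum_const {N : ℕ} (hN : 0 < N) (c θ : ℝ) : fejerSum N (fun _ => c) θ = c := by
  rw [fejerSum_eq_integral continuousOn_const, intervalIntegral.integral_mul_const,
    integral_fejerKernel hN, one_mul]

theorem abs_fejerSum_le {g : ℝ → ℝ} (hg : ContinuousOn g (Icc 0 1)) {M : ℝ}
    (h : ∀ y ∈ Icc (0 : ℝ) 1, |g y| ≤ M) {N : ℕ} (hN : 0 < N) (θ : ℝ) :
    |fejerSum N g θ| ≤ M := by
  have := abs_fejerSum_sub_le hg (b := fun _ => M) continuousOn_const hN 0 θ (by simpa using h)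
  rwa [fejerSum_const hN, sub_zero] at this

/-- The square is a combination of the modes `0`, `1`, `2`, on which the Fejér mean acts by the
factors `1 - m/N`. This is the concentration estimate of Korovkin's argument; mode `2` is why `2 <
N` is required. -/
theorem integral_fejerKernel_mul_sq {N : ℕ} (hN : 2 < N) (θ : ℝ) :
    ∫ y in (0 : ℝ)..1,
      fejerKernel N θ y * (Real.cos (Real.pi * y) - Real.cos (Real.pi * θ)) ^ 2 = 1 / N := by
  have hN0 : (N : ℝ) ≠ 0 := by positivity
  have h1 := fejerSum_cos (N := N) (m := 1) (by omega) θ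
  have h2 := fejerSum_cos (N := N) (m := 2) hN θ
  rw [fejerSum_eq_integral (by fun_prop)] at h1 h2
  have h0 := integral_fejerKernel (N := N) (by omega) θ
  have hk := continuous_fejerKernel N θ
  have e : ∀ y : ℝ,
      fejerKernel N θ y * (Real.cos (Real.pi * y) - Real.cos (Real.pi * θ)) ^ 2 =
      (1 / 2) * (fejerKernel N θ y * Real.cos ((2 : ℕ) * Real.pi * y)) -
      (2 * Real.cos (Real.pi * θ)) * (fejerKernel N θ y * Real.cos ((1 : ℕ) * Real.pi * y)) +
      (1 / 2 + Real.cos (Real.pi * θ) ^ 2) * fejerKernel N θ y := by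
    intro y
    rw [show ((2 : ℕ) : ℝ) * Real.pi * y = 2 * (Real.pi * y) by push_cast; ring, Real.cos_two_mul]
    push_cast
    rw [one_mul]
    ring
  simp_rw [e]
  rw [intervalIntegral.integral_add (Continuous.intervalIntegrable (by fun_prop) _ _)
    (Continuous.intervalIntegrable (by fun_prop) _ _),
    intervalIntegral.integral_sub (Continuous.intervalIntegrable (by fun_prop) _ _)
    (Continuous.intervalIntegrable (by fun_prop) _ _),
    intervalIntegral.integral_const_mul, intervalIntegral.integral_const_mul,
    intervalIntegral.integral_const_mul, h0, h1, h2,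
    show ((2 : ℕ) : ℝ) * Real.pi * θ = 2 * (Real.pi * θ) by push_cast; ring, Real.cos_two_mul]
  push_cast
  rw [one_mul]
  field_simp
  ring

theorem tendsto_fejerSum {g : ℝ → ℝ} (hg : ContinuousOn g (Icc 0 1)) {θ : ℝ}
    (hθ : θ ∈ Icc (0 : ℝ) 1) : Tendsto (fun N => fejerSum N g θ) atTop (𝓝 (g θ)) := by
  obtain ⟨M, hM⟩ := isCompact_Icc.exists_bound_of_continuousOn hg
  have hM0 : 0 ≤ M := (norm_nonneg _).trans (hM θ hθ)
  rw [Metric.tendsto_atTop]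
  intro ε hε
  obtain ⟨δ, hδ, hgδ⟩ := Metric.continuousWithinAt_iff.1 (hg θ hθ) (ε / 2) (half_pos hε)
  -- By compactness and injectivity of `cos` on `[0, π]`, the squared difference of cosines is
  -- bounded below away from `θ`. Thus `ε / 2 + 2M/m` times that square dominates `|g y - g θ|`
  -- everywhere.
  obtain ⟨m, hm, hmδ⟩ : ∃ m : ℝ, 0 < m ∧ ∀ y ∈ Icc (0 : ℝ) 1, δ ≤ |y - θ| →
      m ≤ (Real.cos (Real.pi * y) - Real.cos (Real.pi * θ)) ^ 2 := by
    have hK : IsCompact (Icc (0 : ℝ) 1 ∩ {y | δ ≤ |y - θ|}) :=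
      isCompact_Icc.inter_right (isClosed_le continuous_const (by fun_prop))
    rcases (Icc (0 : ℝ) 1 ∩ {y | δ ≤ |y - θ|}).eq_empty_or_nonempty with h | h
    · refine ⟨1, one_pos, fun y hy hd => ?_⟩
      have : y ∈ Icc (0 : ℝ) 1 ∩ {y | δ ≤ |y - θ|} := ⟨hy, hd⟩
      simp [h] at this
    · obtain ⟨z, hz, hmin⟩ := hK.exists_isMinOn h
        (f := fun y => (Real.cos (Real.pi * y) - Real.cos (Real.pi * θ)) ^ 2) (by fun_prop)
      refine ⟨_, ?_, fun y hy hd => hmin ⟨hy, hd⟩⟩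
      have hne : Real.cos (Real.pi * z) ≠ Real.cos (Real.pi * θ) := by
        intro h
        have hpi := Real.pi_pos
        have mem : ∀ y ∈ Icc (0 : ℝ) 1, Real.pi * y ∈ Icc 0 Real.pi := fun y hy =>
          ⟨mul_nonneg hpi.le hy.1, mul_le_of_le_one_right hpi.le hy.2⟩
        have := mul_left_cancel₀ hpi.ne' (Real.injOn_cos (mem z hz.1) (mem θ hθ) h)
        have hd : δ ≤ |z - θ| := hz.2
        rw [this, sub_self, abs_zero] at hd
        linarith
      exact sq_pos_of_ne_zero (sub_ne_zero.2 hne)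
  obtain ⟨N₀, hN₀⟩ := exists_nat_gt (2 * M / m / (ε / 2))
  refine ⟨max 3 (N₀ + 1), fun N hN => ?_⟩
  have hN3 : 2 < N := (le_max_left 3 (N₀ + 1)).trans hN
  have hNpos : (0 : ℝ) < N := by positivity
  have hNN : 2 * M / m / (ε / 2) < N :=
    hN₀.trans (by exact_mod_cast (Nat.lt_succ_self _).trans_le ((le_max_right _ _).trans hN))
  have hb := abs_fejerSum_sub_le hg
    (b := fun y => ε / 2 + 2 * M / m *
      (Real.cos (Real.pi * y) - Real.cos (Real.pi * θ)) ^ 2) (by fun_prop)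
    (N := N) (by omega) (g θ) θ (by
      intro y hy
      by_cases hd : |y - θ| < δ
      · have := (hgδ hy hd).le
        rw [Real.dist_eq] at this
        have : 0 ≤ 2 * M / m * (Real.cos (Real.pi * y) - Real.cos (Real.pi * θ)) ^ 2 := by
          positivity
        linarith
      · have h1 := hmδ y hy (not_lt.1 hd)
        have h2 : |g y - g θ| ≤ 2 * M := by
          have := abs_sub (g y) (g θ)
          have a1 := hM y hy
          have a2 := hM θ hθ
          rw [Real.norm_eq_abs] at a1 a2
          linarith
        have h3 : 2 * M / m * m ≤ 2 * M / m *
            (Real.cos (Real.pi * y) - Real.cos (Real.pi * θ)) ^ 2 :=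
          mul_le_mul_of_nonneg_left h1 (by positivity)
        rw [div_mul_cancel₀ _ hm.ne'] at h3
        linarith)
  have hval : fejerSum N (fun y => ε / 2 + 2 * M / m *
      (Real.cos (Real.pi * y) - Real.cos (Real.pi * θ)) ^ 2) θ = ε / 2 + 2 * M / m * (1 / N) := by
    have hk := continuous_fejerKernel N θ
    have h1 : ∫ y in (0 : ℝ)..1, fejerKernel N θ y * (ε / 2) = ε / 2 := by
      rw [intervalIntegral.integral_mul_const, integral_fejerKernel (by omega), one_mul]
    have h2 : ∫ y in (0 : ℝ)..1, 2 * M / m * (fejerKernel N θ y *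
        (Real.cos (Real.pi * y) - Real.cos (Real.pi * θ)) ^ 2) = 2 * M / m * (1 / N) := by
      rw [intervalIntegral.integral_const_mul, integral_fejerKernel_mul_sq hN3]
    have h3 := intervalIntegral.integral_add (μ := volume) (a := 0) (b := 1)
      (f := fun y => fejerKernel N θ y * (ε / 2))
      (g := fun y => 2 * M / m * (fejerKernel N θ y *
        (Real.cos (Real.pi * y) - Real.cos (Real.pi * θ)) ^ 2))
      (Continuous.intervalIntegrable (by fun_prop) _ _)
      (Continuous.intervalIntegrable (by fun_prop) _ _)
    rw [h1, h2] at h3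
    rw [fejerSum_eq_integral (by fun_prop), ← h3]
    refine intervalIntegral.integral_congr fun y _ => ?_
    ring
  rw [hval] at hb
  rw [Real.dist_eq]
  have : 2 * M / m * (1 / N) < ε / 2 := by
    rw [div_lt_iff₀ (half_pos hε)] at hNN
    rw [mul_one_div, div_lt_iff₀ hNpos]
    linarith
  linarith

/-! ### The chain rule for the square of a continuous function of bounded variation -/

theorem setIntegral_Ioc_prod_eq_sum {E : Set ℝ} (hE : MeasurableSet E) {μ : Measure (ℝ × ℝ)}
    {ψ : ℝ × ℝ → ℝ} {p : ℕ → ℝ} (hp : Monotone p) (n : ℕ)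
    (hψ : IntegrableOn ψ (Ioc (p 0) (p n) ×ˢ E) μ) :
    ∫ z in Ioc (p 0) (p n) ×ˢ E, ψ z ∂μ =
      ∑ j ∈ Finset.range n, ∫ z in Ioc (p j) (p (j + 1)) ×ˢ E, ψ z ∂μ := by
  induction n with
  | zero => simp
  | succ n ih =>
    have h0 := hp (Nat.zero_le n)
    have h1 := hp (Nat.le_succ n)
    have hU : Ioc (p 0) (p (n + 1)) ×ˢ E = Ioc (p 0) (p n) ×ˢ E ∪ Ioc (p n) (p (n + 1)) ×ˢ E := by
      rw [← union_prod, Ioc_union_Ioc_eq_Ioc h0 h1]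
    rw [hU] at hψ ⊢
    rw [setIntegral_union _ (measurableSet_Ioc.prod hE) (hψ.mono_set subset_union_left)
      (hψ.mono_set subset_union_right), Finset.sum_range_succ,
      ih (hψ.mono_set subset_union_left)]
    rw [Set.disjoint_prod]
    left
    exact Set.disjoint_left.2 fun x hx hx' => absurd hx.2 (not_le.2 hx'.1)

theorem integrableOn_continuousOn_fst_mul {E : Set ℝ} (hE : MeasurableSet E) {a b : ℝ} {u : ℝ → ℝ}
    (hu : ContinuousOn u (Icc a b)) {μ : Measure (ℝ × ℝ)} {φ : ℝ × ℝ → ℝ}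
    (hφ : IntegrableOn φ (Ioc a b ×ˢ E) μ) :
    IntegrableOn (fun p => u p.1 * φ p) (Ioc a b ×ˢ E) μ := by
  obtain ⟨M, hM⟩ := isCompact_Icc.exists_bound_of_continuousOn hu
  have hR : MeasurableSet (Ioc a b ×ˢ E) := measurableSet_Ioc.prod hE
  refine Integrable.bdd_mul (c := M) hφ ?_ ?_
  · refine ContinuousOn.aestronglyMeasurable ?_ hR
    exact hu.comp continuousOn_fst fun p hp => Ioc_subset_Icc_self hp.1
  · filter_upwards [ae_restrict_mem hR] with p hp
    exact hM p.1 (Ioc_subset_Icc_self hp.1)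

/-- Telescoping `u²` over a partition gives factors `u (p (j + 1)) + u (p j)`, which uniform
continuity replaces by `2 u` with error at most `2ε` times the total variation `C`. Equal partitions
suffice, which matters because for rational endpoints all their nodes are rational. -/
theorem sq_sub_sq_eq_sum_setIntegral {ι : Type*} [Fintype ι] {E : Set ℝ} (hE : MeasurableSet E)
    {a b : ℝ} (hab : a < b)
    {u : ℝ → ℝ} (hu : ContinuousOn u (Icc a b)) {μ : ι → Measure (ℝ × ℝ)} {φ : ι → ℝ × ℝ → ℝ}
    (hφ : ∀ i, IntegrableOn (φ i) (Ioc a b ×ˢ E) (μ i))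
    (hinc : ∀ m j : ℕ, j < m → u (a + (b - a) * ((j + 1 : ℕ) / m)) - u (a + (b - a) * (j / m)) =
      ∑ i, ∫ p in Ioc (a + (b - a) * (j / m)) (a + (b - a) * ((j + 1 : ℕ) / m)) ×ˢ E, φ i p ∂(μ i)) :
    u b ^ 2 - u a ^ 2 = ∑ i, ∫ p in Ioc a b ×ˢ E, 2 * u p.1 * φ i p ∂(μ i) := by
  have hba : 0 < b - a := sub_pos.2 hab
  set C := ∑ i, ∫ p in Ioc a b ×ˢ E, |φ i p| ∂(μ i) with hC
  have hC0 : 0 ≤ C := Finset.sum_nonneg fun i _ => integral_nonneg fun _ => abs_nonneg _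
  have huφ : ∀ i, IntegrableOn (fun p => 2 * u p.1 * φ i p) (Ioc a b ×ˢ E) (μ i) := fun i =>
    integrableOn_continuousOn_fst_mul hE (u := fun s => 2 * u s) (by fun_prop) (hφ i)
  have key : ∀ ε > 0, |u b ^ 2 - u a ^ 2 - ∑ i, ∫ p in Ioc a b ×ˢ E, 2 * u p.1 * φ i p ∂(μ i)| ≤
      2 * ε * C := by
    intro ε hε
    obtain ⟨δ, hδ, hδu⟩ := Metric.uniformContinuousOn_iff.1
      (isCompact_Icc.uniformContinuousOn_of_continuous hu) ε hε
    obtain ⟨m, hm⟩ := exists_nat_gt ((b - a) / δ)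
    have hmpos : (0 : ℝ) < m := (div_pos hba hδ).trans hm
    have hm0 : (m : ℝ) ≠ 0 := hmpos.ne'
    set p : ℕ → ℝ := fun j => a + (b - a) * (j / m) with hpdef
    have hpm : Monotone p := by
      intro i j hij
      have : (i : ℝ) ≤ j := by exact_mod_cast hij
      simp only [hpdef]
      gcongr
    have hp0 : p 0 = a := by simp [hpdef]
    have hpm' : p m = b := by simp [hpdef, hm0]
    have hstep : ∀ j, p (j + 1) - p j < δ := by
      intro j
      have : p (j + 1) - p j = (b - a) / m := by simp only [hpdef]; push_cast; field_simp; ring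
      rw [this, div_lt_iff₀ hmpos]
      rwa [div_lt_iff₀ hδ, mul_comm] at hm
    have hmem : ∀ j ≤ m, p j ∈ Icc a b := fun j hj =>
      ⟨hp0 ▸ hpm (Nat.zero_le j), hpm' ▸ hpm hj⟩
    have hsub : ∀ j < m, Ioc (p j) (p (j + 1)) ×ˢ E ⊆ Ioc a b ×ˢ E := fun j hj =>
      prod_mono (Ioc_subset_Ioc (hmem j hj.le).1 (hmem (j + 1) hj).2) Subset.rfl
    have hsplit : ∀ {i : ι} {ψ : ℝ × ℝ → ℝ}, IntegrableOn ψ (Ioc a b ×ˢ E) (μ i) →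
        ∫ z in Ioc a b ×ˢ E, ψ z ∂(μ i) =
        ∑ j ∈ Finset.range m, ∫ z in Ioc (p j) (p (j + 1)) ×ˢ E, ψ z ∂(μ i) := by
      intro i ψ hψ
      have := setIntegral_Ioc_prod_eq_sum (μ := μ i) (ψ := ψ) hE hpm m (by rwa [hp0, hpm'])
      rwa [hp0, hpm'] at this
    have hsq : u b ^ 2 - u a ^ 2 = ∑ j ∈ Finset.range m, ∑ i,
        ∫ z in Ioc (p j) (p (j + 1)) ×ˢ E, (u (p (j + 1)) + u (p j)) * φ i z ∂(μ i) := by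
      have := Finset.sum_range_sub (fun j => u (p j) ^ 2) m
      rw [hp0, hpm'] at this
      rw [← this]
      refine Finset.sum_congr rfl fun j hj => ?_
      have h := hinc m j (Finset.mem_range.1 hj)
      simp_rw [integral_const_mul]
      rw [← Finset.mul_sum, ← h]
      ring
    have hdiff : u b ^ 2 - u a ^ 2 - ∑ i, ∫ p in Ioc a b ×ˢ E, 2 * u p.1 * φ i p ∂(μ i) =
        ∑ i, ∑ j ∈ Finset.range m, ∫ z in Ioc (p j) (p (j + 1)) ×ˢ E,
          ((u (p (j + 1)) + u (p j)) - 2 * u z.1) * φ i z ∂(μ i) := by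
      rw [hsq, Finset.sum_comm, ← Finset.sum_sub_distrib]
      refine Finset.sum_congr rfl fun i _ => ?_
      rw [hsplit (huφ i), ← Finset.sum_sub_distrib]
      refine Finset.sum_congr rfl fun j hj => ?_
      have hs := hsub j (Finset.mem_range.1 hj)
      rw [← integral_sub (((hφ i).mono_set hs).const_mul _) ((huφ i).mono_set hs)]
      simp_rw [sub_mul]
    rw [hdiff, hC, Finset.mul_sum]
    refine (Finset.abs_sum_le_sum_abs _ _).trans (Finset.sum_le_sum fun i _ => ?_)
    rw [hsplit (hφ i).abs, Finset.mul_sum]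
    refine (Finset.abs_sum_le_sum_abs _ _).trans (Finset.sum_le_sum fun j hj => ?_)
    have hjm := Finset.mem_range.1 hj
    have hs := hsub j hjm
    rw [← integral_const_mul]
    refine (Real.norm_eq_abs _).symm.trans_le
      (norm_integral_le_of_norm_le (((hφ i).mono_set hs).abs.const_mul _) ?_)
    filter_upwards [ae_restrict_mem (measurableSet_Ioc.prod hE)] with z hz
    have hz1 : z.1 ∈ Icc a b := Ioc_subset_Icc_self (hs hz).1
    have hz' : p j < z.1 ∧ z.1 ≤ p (j + 1) := hz.1
    have hst := hstep j
    have d1 := hδu (p (j + 1)) (hmem _ hjm) z.1 hz1 (by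
      rw [Real.dist_eq, abs_lt]; constructor <;> linarith)
    have d2 := hδu (p j) (hmem _ hjm.le) z.1 hz1 (by
      rw [Real.dist_eq, abs_lt]; constructor <;> linarith)
    rw [Real.dist_eq, abs_lt] at d1 d2
    rw [norm_mul, Real.norm_eq_abs, Real.norm_eq_abs]
    refine mul_le_mul_of_nonneg_right ?_ (abs_nonneg _)
    rw [abs_le]
    constructor <;> linarith
  have h0 : |u b ^ 2 - u a ^ 2 - ∑ i, ∫ p in Ioc a b ×ˢ E, 2 * u p.1 * φ i p ∂(μ i)| ≤ 0 := by
    refine le_of_forall_pos_le_add fun ε hε => ?_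
    refine (key (ε / (2 * (C + 1))) (by positivity)).trans ?_
    rw [zero_add, show 2 * (ε / (2 * (C + 1))) * C = ε * (C / (C + 1)) by field_simp]
    exact mul_le_of_le_one_right hε.le ((div_le_one (by positivity)).2 (by linarith))
  exact sub_eq_zero.1 (abs_eq_zero.1 (le_antisymm h0 (abs_nonneg _)))

/-! ### The energy inequality in `V_{-1}` -/

theorem continuousOn_cosIntegral {Z : ℝ → ℝ → ℝ} {a b : ℝ}
    (hZ : ContinuousOn (fun p : ℝ × ℝ => Z p.1 p.2) (Icc a b ×ˢ Icc 0 1)) (k : ℕ) :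
    ContinuousOn (fun t => cosIntegral k (Z t)) (Icc a b) := by
  rcases lt_or_ge b a with hab | hab
  · simp [Icc_eq_empty_of_lt hab]
  -- Composing with the projections onto the two intervals extends `Z` to a globally continuous
  -- function with the same integrals.
  have hc : Continuous fun p : ℝ × ℝ =>
      Z (projIcc a b hab p.1) (projIcc (0 : ℝ) 1 zero_le_one p.2) :=
    hZ.comp_continuous (f := fun p : ℝ × ℝ => ((projIcc a b hab p.1 : ℝ),
      (projIcc (0 : ℝ) 1 zero_le_one p.2 : ℝ)))
      ((continuous_subtype_val.comp (continuous_projIcc.comp continuous_fst)).prodMk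
        (continuous_subtype_val.comp (continuous_projIcc.comp continuous_snd)))
      fun p => ⟨Subtype.coe_prop _, Subtype.coe_prop _⟩
  have h2 : Continuous fun t => ∫ y in (0 : ℝ)..1,
      Z (projIcc a b hab t) (projIcc (0 : ℝ) 1 zero_le_one y) * Real.cos (k * Real.pi * y) := by
    apply intervalIntegral.continuous_parametric_intervalIntegral_of_continuous'
    exact hc.mul (by fun_prop)
  refine h2.continuousOn.congr fun t ht => ?_
  refine intervalIntegral.integral_congr fun y hy => ?_
  rw [uIcc_of_le zero_le_one] at hy
  simp [projIcc_of_mem _ ht, projIcc_of_mem _ hy]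

theorem continuousOn_section {Z : ℝ → ℝ → ℝ} {S E : Set ℝ}
    (hZ : ContinuousOn (fun p : ℝ × ℝ => Z p.1 p.2) (S ×ˢ E)) {t : ℝ} (ht : t ∈ S) :
    ContinuousOn (Z t) E :=
  hZ.comp (f := fun θ => (t, θ)) (by fun_prop) fun _ hθ => ⟨ht, hθ⟩

theorem continuousOn_fejerSum {Z : ℝ → ℝ → ℝ} {a b : ℝ}
    (hZ : ContinuousOn (fun p : ℝ × ℝ => Z p.1 p.2) (Icc a b ×ˢ Icc 0 1)) (N : ℕ) :
    ContinuousOn (fun p : ℝ × ℝ => fejerSum N (Z p.1) p.2) (Icc a b ×ˢ Icc 0 1) := by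
  unfold fejerSum
  refine continuousOn_finsetSum _ fun k _ => ?_
  have h : ContinuousOn (fun p : ℝ × ℝ => cosIntegral k (Z p.1)) (Icc a b ×ˢ Icc 0 1) :=
    (continuousOn_cosIntegral hZ k).comp continuousOn_fst fun p hp => hp.1
  exact (h.const_mul _).mul (by fun_prop)

/-- Dominated convergence: the Fejér means converge at every point and are bounded by the supremum
of `|Z|`. Since no null set is discarded, the measure `μ` may be singular. -/
theorem tendsto_integral_fejerSum_mul {Z : ℝ → ℝ → ℝ} {a b : ℝ}
    (hZ : ContinuousOn (fun p : ℝ × ℝ => Z p.1 p.2) (Icc a b ×ˢ Icc 0 1))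
    {μ : Measure (ℝ × ℝ)} {F : ℝ × ℝ → ℝ} (hF : IntegrableOn F (Ioc a b ×ˢ Icc 0 1) μ) :
    Tendsto (fun N => ∫ p in Ioc a b ×ˢ Icc 0 1, fejerSum N (Z p.1) p.2 * F p ∂μ) atTop
      (𝓝 (∫ p in Ioc a b ×ˢ Icc 0 1, Z p.1 p.2 * F p ∂μ)) := by
  obtain ⟨M, hM⟩ := (isCompact_Icc.prod isCompact_Icc).exists_bound_of_continuousOn hZ
  have hR : MeasurableSet (Ioc a b ×ˢ Icc (0 : ℝ) 1) := measurableSet_Ioc.prod measurableSet_Icc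
  have hsub : Ioc a b ×ˢ Icc (0 : ℝ) 1 ⊆ Icc a b ×ˢ Icc 0 1 :=
    prod_mono Ioc_subset_Icc_self Subset.rfl
  have hM' : ∀ p ∈ Ioc a b ×ˢ Icc (0 : ℝ) 1, ∀ N, |fejerSum N (Z p.1) p.2| ≤ M := by
    intro p hp N
    rcases Nat.eq_zero_or_pos N with rfl | hN
    · simpa [fejerSum] using (norm_nonneg _).trans (hM p (hsub hp))
    · exact abs_fejerSum_le (continuousOn_section hZ (hsub hp).1)
        (fun y hy => hM (p.1, y) ⟨(hsub hp).1, hy⟩) hN _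
  refine tendsto_integral_of_dominated_convergence (fun p => M * ‖F p‖) (fun N => ?_)
    (hF.norm.const_mul M) (fun N => ?_) ?_
  · exact (((continuousOn_fejerSum hZ N).mono hsub).aestronglyMeasurable hR).mul
      hF.aestronglyMeasurable
  · filter_upwards [ae_restrict_mem hR] with p hp
    rw [norm_mul]
    exact mul_le_mul_of_nonneg_right (hM' p hp N) (norm_nonneg _)
  · filter_upwards [ae_restrict_mem hR] with p hp
    exact (tendsto_fejerSum (continuousOn_section hZ (hsub hp).1) hp.2).mul_const _

/-- The identity satisfied by the increments of the cosine coefficients of the difference `Z` of two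
solutions. -/
def CosIncrement (κ : ℝ) (Z : ℝ → ℝ → ℝ) (F : ℝ × ℝ → ℝ) (η ξ : Measure (ℝ × ℝ)) (k : ℕ)
    (s t : ℝ) : Prop :=
  cosIntegral k (Z t) - cosIntegral k (Z s) =
    (∫ p in Ioc s t ×ˢ Icc 0 1, Real.cos (k * Real.pi * p.2) *
      (κ * (k * Real.pi) ^ 2 * F p - κ * (k * Real.pi) ^ 4 * Z p.1 p.2)) +
    (∫ p in Ioc s t ×ˢ Icc 0 1, κ * (k * Real.pi) ^ 2 * Real.cos (k * Real.pi * p.2) ∂η) +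
    ∫ p in Ioc s t ×ˢ Icc 0 1, -(κ * (k * Real.pi) ^ 2 * Real.cos (k * Real.pi * p.2)) ∂ξ

theorem integrableOn_cos_mul {μ : Measure (ℝ × ℝ)} {F : ℝ × ℝ → ℝ} {S : Set (ℝ × ℝ)}
    (hF : IntegrableOn F S μ) (c : ℝ) : IntegrableOn (fun p => Real.cos (c * p.2) * F p) S μ :=
  Integrable.bdd_mul (c := 1) hF
    ((by fun_prop : Continuous fun p : ℝ × ℝ => Real.cos (c * p.2)).aestronglyMeasurable)
    (Eventually.of_forall fun _ => Real.abs_cos_le_one _)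

/-- The chain rule is applied to the `k`-th coefficient with the three measures `volume`, `η`, `ξ`.
Dividing by the eigenvalue `(kπ)²` produces the `V_{-1}` weight, and the fourth-order term is
dropped because of its sign. -/
theorem cosIntegral_sq_sub_sq_le {κ a b : ℝ} (hκ : 0 < κ) (hab : a < b) {Z : ℝ → ℝ → ℝ}
    (hZ : ContinuousOn (fun p : ℝ × ℝ => Z p.1 p.2) (Icc a b ×ˢ Icc 0 1))
    {F : ℝ × ℝ → ℝ} (hF : IntegrableOn F (Ioc a b ×ˢ Icc 0 1)) {η ξ : Measure (ℝ × ℝ)}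
    (hη : η (Ioc a b ×ˢ Icc 0 1) ≠ ∞) (hξ : ξ (Ioc a b ×ˢ Icc 0 1) ≠ ∞)
    {k : ℕ} (hk : k ≠ 0)
    (hinc : ∀ m j : ℕ, j < m →
      CosIncrement κ Z F η ξ k (a + (b - a) * (j / m)) (a + (b - a) * ((j + 1 : ℕ) / m))) :
    ((k * Real.pi) ^ 2)⁻¹ * (cosIntegral k (Z b) ^ 2 - cosIntegral k (Z a) ^ 2) ≤
      2 * κ * ((∫ p in Ioc a b ×ˢ Icc 0 1,
          cosIntegral k (Z p.1) * (Real.cos (k * Real.pi * p.2) * F p)) +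
        (∫ p in Ioc a b ×ˢ Icc 0 1,
          cosIntegral k (Z p.1) * Real.cos (k * Real.pi * p.2) ∂η) -
        ∫ p in Ioc a b ×ˢ Icc 0 1,
          cosIntegral k (Z p.1) * Real.cos (k * Real.pi * p.2) ∂ξ) := by
  have hu := continuousOn_cosIntegral hZ k
  have hR : MeasurableSet (Ioc a b ×ˢ Icc (0 : ℝ) 1) := measurableSet_Ioc.prod measurableSet_Icc
  set l : ℝ := (k * Real.pi) ^ 2 with hl
  have hl4 : (k * Real.pi) ^ 4 = l ^ 2 := by rw [hl]; ring
  have hl0 : 0 < l := by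
    have : (0 : ℝ) < k := by exact_mod_cast Nat.pos_of_ne_zero hk
    have := Real.pi_pos
    positivity
  have hZi : IntegrableOn (fun p : ℝ × ℝ => Z p.1 p.2) (Ioc a b ×ˢ Icc 0 1) :=
    (hZ.integrableOn_compact (isCompact_Icc.prod isCompact_Icc)).mono_set
      (prod_mono Ioc_subset_Icc_self Subset.rfl)
  have hcF := integrableOn_cos_mul hF (k * Real.pi)
  have hcZ := integrableOn_cos_mul hZi (k * Real.pi)
  have hφ0 : IntegrableOn (fun p : ℝ × ℝ => Real.cos (k * Real.pi * p.2) *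
      (κ * l * F p - κ * l ^ 2 * Z p.1 p.2)) (Ioc a b ×ˢ Icc 0 1) := by
    refine ((hcF.const_mul (κ * l)).sub (hcZ.const_mul (κ * l ^ 2))).congr ?_
    refine Eventually.of_forall fun p => ?_
    simp only [Pi.sub_apply]
    ring
  have hφ1 : ∀ {μ : Measure (ℝ × ℝ)}, μ (Ioc a b ×ˢ Icc 0 1) ≠ ∞ → ∀ c : ℝ,
      IntegrableOn (fun p : ℝ × ℝ => c * Real.cos (k * Real.pi * p.2)) (Ioc a b ×ˢ Icc 0 1) μ := by
    intro μ hμ c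
    have := (integrableOn_cos_mul (integrableOn_const (C := (1 : ℝ)) hμ) (k * Real.pi)).const_mul c
    simp only [mul_one] at this
    exact this
  have hchain := sq_sub_sq_eq_sum_setIntegral (ι := Fin 3) measurableSet_Icc hab hu
    (μ := ![volume, η, ξ])
    (φ := ![fun p => Real.cos (k * Real.pi * p.2) * (κ * l * F p - κ * l ^ 2 * Z p.1 p.2),
      fun p => κ * l * Real.cos (k * Real.pi * p.2),
      fun p => -(κ * l * Real.cos (k * Real.pi * p.2))])
    (by
      intro i
      fin_cases i
      · exact hφ0
      · exact hφ1 hη _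
      · exact (hφ1 hξ _).neg)
    (by
      intro m j hj
      rw [Fin.sum_univ_three]
      have := hinc m j hj
      rw [CosIncrement, hl4, ← hl] at this
      exact this)
  rw [Fin.sum_univ_three] at hchain
  simp only [Matrix.cons_val_zero, Matrix.cons_val_one, Matrix.cons_val] at hchain
  have e0 : ∫ p in Ioc a b ×ˢ Icc 0 1, 2 * cosIntegral k (Z p.1) *
      (Real.cos (k * Real.pi * p.2) * (κ * l * F p - κ * l ^ 2 * Z p.1 p.2)) =
      2 * κ * l * (∫ p in Ioc a b ×ˢ Icc 0 1,
          cosIntegral k (Z p.1) * (Real.cos (k * Real.pi * p.2) * F p)) -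
      2 * κ * l ^ 2 * ∫ p in Ioc a b ×ˢ Icc 0 1,
          cosIntegral k (Z p.1) * (Real.cos (k * Real.pi * p.2) * Z p.1 p.2) := by
    rw [← integral_const_mul, ← integral_const_mul, ← integral_sub
      ((integrableOn_continuousOn_fst_mul measurableSet_Icc hu hcF).const_mul _)
      ((integrableOn_continuousOn_fst_mul measurableSet_Icc hu hcZ).const_mul _)]
    congr 1
    ext p
    ring
  have e1 : ∀ (μ : Measure (ℝ × ℝ)) (c : ℝ), ∫ p in Ioc a b ×ˢ Icc 0 1, 2 * cosIntegral k (Z p.1) *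
      (c * Real.cos (k * Real.pi * p.2)) ∂μ =
      2 * c * ∫ p in Ioc a b ×ˢ Icc 0 1,
          cosIntegral k (Z p.1) * Real.cos (k * Real.pi * p.2) ∂μ := by
    intro μ c
    rw [← integral_const_mul]
    congr 1
    ext p
    ring
  -- By Fubini, the dissipation integral is the time integral of the squared coefficient.
  have e2 : 0 ≤ ∫ p in Ioc a b ×ˢ Icc 0 1,
      cosIntegral k (Z p.1) * (Real.cos (k * Real.pi * p.2) * Z p.1 p.2) := by
    have hi := integrableOn_continuousOn_fst_mul measurableSet_Icc hu hcZ
    rw [Measure.volume_eq_prod] at hi ⊢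
    rw [setIntegral_prod _ hi]
    refine integral_nonneg fun s => ?_
    have : ∫ y in Icc (0 : ℝ) 1, cosIntegral k (Z s) * (Real.cos (k * Real.pi * y) * Z s y) =
        cosIntegral k (Z s) ^ 2 := by
      rw [integral_const_mul, integral_Icc_eq_integral_Ioc,
        ← intervalIntegral.integral_of_le zero_le_one, sq]
      unfold cosIntegral
      simp_rw [mul_comm (Z s _)]
    simp only [this, Pi.zero_apply]
    positivity
  simp_rw [← neg_mul] at hchain
  rw [e0, e1, e1] at hchain
  rw [hchain, ← sub_nonneg]
  set I0 := ∫ p in Ioc a b ×ˢ Icc 0 1, cosIntegral k (Z p.1) * (Real.cos (k * Real.pi * p.2) * F p)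
  set I1 := ∫ p in Ioc a b ×ˢ Icc 0 1, cosIntegral k (Z p.1) * Real.cos (k * Real.pi * p.2) ∂η
  set I2 := ∫ p in Ioc a b ×ˢ Icc 0 1, cosIntegral k (Z p.1) * Real.cos (k * Real.pi * p.2) ∂ξ
  set I3 := ∫ p in Ioc a b ×ˢ Icc 0 1,
    cosIntegral k (Z p.1) * (Real.cos (k * Real.pi * p.2) * Z p.1 p.2)
  have : 2 * κ * (I0 + I1 - I2) - l⁻¹ * (2 * κ * l * I0 - 2 * κ * l ^ 2 * I3 + 2 * (κ * l) * I1 +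
      2 * (-(κ * l)) * I2) = 2 * κ * l * I3 := by
    field_simp
    ring
  simp only [neg_mul] at this ⊢
  rw [this]
  positivity

theorem sum_fejerWeight_mul_sq_sub_le {κ a b : ℝ} (hκ : 0 < κ) (hab : a < b) {Z : ℝ → ℝ → ℝ}
    (hZ : ContinuousOn (fun p : ℝ × ℝ => Z p.1 p.2) (Icc a b ×ˢ Icc 0 1))
    {F : ℝ × ℝ → ℝ} (hF : IntegrableOn F (Ioc a b ×ˢ Icc 0 1)) {η ξ : Measure (ℝ × ℝ)}
    (hη : η (Ioc a b ×ˢ Icc 0 1) ≠ ∞) (hξ : ξ (Ioc a b ×ˢ Icc 0 1) ≠ ∞)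
    (h0 : ∀ t ∈ Icc a b, cosIntegral 0 (Z t) = 0)
    (hinc : ∀ k : ℕ, k ≠ 0 → ∀ m j : ℕ, j < m →
      CosIncrement κ Z F η ξ k (a + (b - a) * (j / m)) (a + (b - a) * ((j + 1 : ℕ) / m))) (N : ℕ) :
    ∑ k ∈ Finset.range N, fejerWeight N k * (((k * Real.pi) ^ 2)⁻¹ *
      (cosIntegral k (Z b) ^ 2 - cosIntegral k (Z a) ^ 2)) ≤
      2 * κ * ((∫ p in Ioc a b ×ˢ Icc 0 1, fejerSum N (Z p.1) p.2 * F p) +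
        (∫ p in Ioc a b ×ˢ Icc 0 1, fejerSum N (Z p.1) p.2 * 1 ∂η) -
        ∫ p in Ioc a b ×ˢ Icc 0 1, fejerSum N (Z p.1) p.2 * 1 ∂ξ) := by
  have hR : MeasurableSet (Ioc a b ×ˢ Icc (0 : ℝ) 1) := measurableSet_Ioc.prod measurableSet_Icc
  have hexp : ∀ {μ : Measure (ℝ × ℝ)} {G : ℝ × ℝ → ℝ}, IntegrableOn G (Ioc a b ×ˢ Icc 0 1) μ →
      ∫ p in Ioc a b ×ˢ Icc 0 1, fejerSum N (Z p.1) p.2 * G p ∂μ =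
      ∑ k ∈ Finset.range N, fejerWeight N k * ∫ p in Ioc a b ×ˢ Icc 0 1,
          cosIntegral k (Z p.1) * (Real.cos (k * Real.pi * p.2) * G p) ∂μ := by
    intro μ G hG
    simp_rw [← integral_const_mul]
    rw [← integral_finsetSum]
    · congr 1
      ext p
      rw [fejerSum, Finset.sum_mul]
      refine Finset.sum_congr rfl fun k _ => ?_
      ring
    · intro k _
      exact (integrableOn_continuousOn_fst_mul measurableSet_Icc (continuousOn_cosIntegral hZ k)
        (integrableOn_cos_mul hG _)).const_mul _
  rw [hexp hF, hexp (integrableOn_const hη), hexp (integrableOn_const hξ),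
    ← Finset.sum_add_distrib, ← Finset.sum_sub_distrib, Finset.mul_sum]
  refine Finset.sum_le_sum fun k hk => ?_
  rw [← mul_add, ← mul_sub, mul_left_comm (2 * κ)]
  refine mul_le_mul_of_nonneg_left ?_ (fejerWeight_nonneg (Finset.mem_range.1 hk))
  simp only [mul_one]
  by_cases hk0 : k = 0
  -- The mode `0` contributes nothing on either side: on the left `0⁻¹ = 0`, on the right the mean
  -- of `Z` vanishes.
  · subst hk0
    have hz : ∀ (μ : Measure (ℝ × ℝ)) (G : ℝ × ℝ → ℝ),
        ∫ p in Ioc a b ×ˢ Icc 0 1, cosIntegral 0 (Z p.1) * G p ∂μ = 0 := by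
      intro μ G
      refine setIntegral_eq_zero_of_forall_eq_zero fun p hp => ?_
      rw [h0 p.1 (Ioc_subset_Icc_self hp.1), zero_mul]
    have e1 := hz η fun _ => 1
    have e2 := hz ξ fun _ => 1
    simp only [mul_one] at e1 e2
    simp [hz, e1, e2]
  · exact cosIntegral_sq_sub_sq_le hκ hab hZ hF hη hξ hk0 (hinc k hk0)

/-- The sum over modes is tested with the Fejér weights, which are nonnegative, at most `2`, and
tend to `2` for fixed `k ≠ 0`. One term is kept at time `b`, all are kept at time `a`, and in the
limit `N → ∞` the right-hand side has the sign given by `hZF`, `hZη`, `hZξ`. -/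
theorem inv_mul_cosIntegral_sq_le {κ a b : ℝ} (hκ : 0 < κ) (hab : a < b) {Z : ℝ → ℝ → ℝ}
    (hZ : ContinuousOn (fun p : ℝ × ℝ => Z p.1 p.2) (Icc a b ×ˢ Icc 0 1))
    {F : ℝ × ℝ → ℝ} (hF : IntegrableOn F (Ioc a b ×ˢ Icc 0 1)) {η ξ : Measure (ℝ × ℝ)}
    (hη : η (Ioc a b ×ˢ Icc 0 1) ≠ ∞) (hξ : ξ (Ioc a b ×ˢ Icc 0 1) ≠ ∞)
    (h0 : ∀ t ∈ Icc a b, cosIntegral 0 (Z t) = 0)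
    (hinc : ∀ k : ℕ, k ≠ 0 → ∀ m j : ℕ, j < m →
      CosIncrement κ Z F η ξ k (a + (b - a) * (j / m)) (a + (b - a) * ((j + 1 : ℕ) / m)))
    (hZF : ∫ p in Ioc a b ×ˢ Icc 0 1, Z p.1 p.2 * F p ≤ 0)
    (hZη : ∫ p in Ioc a b ×ˢ Icc 0 1, Z p.1 p.2 ∂η ≤ 0)
    (hZξ : 0 ≤ ∫ p in Ioc a b ×ˢ Icc 0 1, Z p.1 p.2 ∂ξ) {B : ℝ}
    (hB : ∀ N, ∑ k ∈ Finset.range N, ((k * Real.pi) ^ 2)⁻¹ * cosIntegral k (Z a) ^ 2 ≤ B)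
    {k : ℕ} (hk : k ≠ 0) : ((k * Real.pi) ^ 2)⁻¹ * cosIntegral k (Z b) ^ 2 ≤ B := by
  have hlim := (((tendsto_integral_fejerSum_mul hZ hF).add
    (tendsto_integral_fejerSum_mul hZ (integrableOn_const (C := (1 : ℝ)) hη))).sub
    (tendsto_integral_fejerSum_mul hZ (integrableOn_const (C := (1 : ℝ)) hξ))).const_mul (2 * κ)
  have hL := (tendsto_fejerWeight hk).mul_const (((k * Real.pi) ^ 2)⁻¹ * cosIntegral k (Z b) ^ 2)
  have hle := le_of_tendsto_of_tendsto hL (hlim.const_add (2 * B)) (by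
    filter_upwards [eventually_gt_atTop k] with N hN
    have h1 := sum_fejerWeight_mul_sq_sub_le hκ hab hZ hF hη hξ h0 hinc N
    have h2 : fejerWeight N k * (((k * Real.pi) ^ 2)⁻¹ * cosIntegral k (Z b) ^ 2) ≤
        ∑ k ∈ Finset.range N, fejerWeight N k *
          (((k * Real.pi) ^ 2)⁻¹ * cosIntegral k (Z b) ^ 2) :=
      Finset.single_le_sum (f := fun k : ℕ => fejerWeight N k *
          (((k * Real.pi) ^ 2)⁻¹ * cosIntegral k (Z b) ^ 2))
        (fun i hi => mul_nonneg (fejerWeight_nonneg (Finset.mem_range.1 hi)) (by positivity))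
        (Finset.mem_range.2 hN)
    have h3 : ∑ k ∈ Finset.range N, fejerWeight N k *
          (((k * Real.pi) ^ 2)⁻¹ * cosIntegral k (Z a) ^ 2) ≤ 2 * B := by
      refine le_trans ?_ (mul_le_mul_of_nonneg_left (hB N) zero_le_two)
      rw [Finset.mul_sum]
      exact Finset.sum_le_sum fun i _ =>
        mul_le_mul_of_nonneg_right (fejerWeight_le_two N i) (by positivity)
    simp_rw [mul_sub, Finset.sum_sub_distrib] at h1
    simp_rw [mul_sub]
    linarith)
  simp only [mul_one] at hle
  have : 2 * κ * ((∫ p in Ioc a b ×ˢ Icc 0 1, Z p.1 p.2 * F p) +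
      (∫ p in Ioc a b ×ˢ Icc 0 1, Z p.1 p.2 ∂η) - ∫ p in Ioc a b ×ˢ Icc 0 1, Z p.1 p.2 ∂ξ) ≤ 0 :=
    mul_nonpos_of_nonneg_of_nonpos (by positivity) (by linarith)
  linarith

/-! ### Identification of the reflection measures -/

/-- In the Fejér expansion of `g` all modes `k ≥ 1` cancel between the two measures, so only the
constant mode remains. -/
theorem integral_sub_integral_eq_of_cos {a b : ℝ} {η ξ : Measure (ℝ × ℝ)}
    (hη : η (Ioc a b ×ˢ Icc 0 1) ≠ ∞) (hξ : ξ (Ioc a b ×ˢ Icc 0 1) ≠ ∞)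
    (hcos : ∀ k : ℕ, k ≠ 0 → ∫ p in Ioc a b ×ˢ Icc 0 1, Real.cos (k * Real.pi * p.2) ∂η =
      ∫ p in Ioc a b ×ˢ Icc 0 1, Real.cos (k * Real.pi * p.2) ∂ξ)
    {g : ℝ → ℝ} (hg : ContinuousOn g (Icc 0 1)) :
    ∫ p in Ioc a b ×ˢ Icc 0 1, g p.2 ∂η - ∫ p in Ioc a b ×ˢ Icc 0 1, g p.2 ∂ξ =
      cosIntegral 0 g * (η.real (Ioc a b ×ˢ Icc 0 1) - ξ.real (Ioc a b ×ˢ Icc 0 1)) := by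
  have hZ : ContinuousOn (fun p : ℝ × ℝ => (fun _ => g : ℝ → ℝ → ℝ) p.1 p.2)
      (Icc a b ×ˢ Icc 0 1) := hg.comp continuousOn_snd fun p hp => hp.2
  have hlim := (tendsto_integral_fejerSum_mul (Z := fun _ => g) hZ (integrableOn_const (C := (1 : ℝ)) hη)).sub
    (tendsto_integral_fejerSum_mul (Z := fun _ => g) hZ (integrableOn_const (C := (1 : ℝ)) hξ))
  simp only [mul_one] at hlim
  refine tendsto_nhds_unique hlim (tendsto_const_nhds.congr' ?_)
  filter_upwards [eventually_gt_atTop 0] with N hN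
  have hexp : ∀ {μ : Measure (ℝ × ℝ)}, μ (Ioc a b ×ˢ Icc 0 1) ≠ ∞ →
      ∫ p in Ioc a b ×ˢ Icc 0 1, fejerSum N g p.2 ∂μ =
      ∑ k ∈ Finset.range N, fejerWeight N k * cosIntegral k g *
        ∫ p in Ioc a b ×ˢ Icc 0 1, Real.cos (k * Real.pi * p.2) ∂μ := by
    intro μ hμ
    simp_rw [← integral_const_mul]
    rw [← integral_finsetSum]
    · rfl
    · intro k _
      have := (integrableOn_cos_mul (integrableOn_const (C := (1 : ℝ)) hμ) (k * Real.pi)).const_mul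
        (fejerWeight N k * cosIntegral k g)
      simpa only [mul_one] using this
  rw [hexp hη, hexp hξ, ← Finset.sum_sub_distrib, Finset.sum_eq_single 0]
  · simp [fejerWeight, mul_sub]
  · intro k _ hk
    rw [hcos k hk, sub_self]
  · intro h
    exact absurd (Finset.mem_range.2 hN) h

/-- A function `g` of nonzero mean whose integrals vanish for both measures forces equal masses; the
spatial marginals then agree on continuous functions. -/
theorem measure_prod_eq_of_cos {a b : ℝ} {η ξ : Measure (ℝ × ℝ)}
    (hη : η (Ioc a b ×ˢ Icc 0 1) ≠ ∞) (hξ : ξ (Ioc a b ×ˢ Icc 0 1) ≠ ∞)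
    (hcos : ∀ k : ℕ, k ≠ 0 → ∫ p in Ioc a b ×ˢ Icc 0 1, Real.cos (k * Real.pi * p.2) ∂η =
      ∫ p in Ioc a b ×ˢ Icc 0 1, Real.cos (k * Real.pi * p.2) ∂ξ)
    {g : ℝ → ℝ} (hg : ContinuousOn g (Icc 0 1)) (hg0 : cosIntegral 0 g ≠ 0)
    (hgη : ∫ p in Ioc a b ×ˢ Icc 0 1, g p.2 ∂η = 0)
    (hgξ : ∫ p in Ioc a b ×ˢ Icc 0 1, g p.2 ∂ξ = 0) {D : Set ℝ} (hD : MeasurableSet D) :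
    η (Ioc a b ×ˢ (D ∩ Icc 0 1)) = ξ (Ioc a b ×ˢ (D ∩ Icc 0 1)) := by
  have hmass : η.real (Ioc a b ×ˢ Icc 0 1) - ξ.real (Ioc a b ×ˢ Icc 0 1) = 0 := by
    have := integral_sub_integral_eq_of_cos hη hξ hcos hg
    rw [hgη, hgξ, sub_self, eq_comm, mul_eq_zero] at this
    exact this.resolve_left hg0
  have : IsFiniteMeasure (η.restrict (Ioc a b ×ˢ Icc 0 1)) := ⟨by simpa using hη.lt_top⟩
  have : IsFiniteMeasure (ξ.restrict (Ioc a b ×ˢ Icc 0 1)) := ⟨by simpa using hξ.lt_top⟩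
  have h : (η.restrict (Ioc a b ×ˢ Icc 0 1)).map Prod.snd =
      (ξ.restrict (Ioc a b ×ˢ Icc 0 1)).map Prod.snd := by
    refine ext_of_forall_integral_eq_of_IsFiniteMeasure fun φ => ?_
    rw [integral_map measurable_snd.aemeasurable φ.continuous.aestronglyMeasurable,
      integral_map measurable_snd.aemeasurable φ.continuous.aestronglyMeasurable]
    have := integral_sub_integral_eq_of_cos hη hξ hcos φ.continuous.continuousOn
    rw [hmass, mul_zero] at this
    exact sub_eq_zero.1 this
  have h2 := congrArg (fun m => m D) h
  simp only [Measure.map_apply measurable_snd hD,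
    Measure.restrict_apply (measurable_snd hD)] at h2
  have e : Prod.snd ⁻¹' D ∩ Ioc a b ×ˢ Icc (0 : ℝ) 1 = Ioc a b ×ˢ (D ∩ Icc 0 1) := by
    ext p
    simp only [mem_inter_iff, mem_preimage, mem_prod]
    tauto
  rwa [e] at h2

/-- For a fixed space set `D`, both sides are finite measures in time, and intervals with endpoints
in `T·ℚ` form a generating π-system. The `max` and `min` come from intersecting these intervals with
`(s, t]`. -/
theorem restrict_eq_of_Ioc_prod {T : ℝ} (hT : 0 < T) {s t : ℝ} {η ξ : Measure (ℝ × ℝ)}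
    (hη : η (Ioc s t ×ˢ Icc 0 1) ≠ ∞) (hξ : ξ (Ioc s t ×ˢ Icc 0 1) ≠ ∞)
    (h : ∀ q r : ℚ, ∀ D : Set ℝ, MeasurableSet D →
      η (Ioc (max (T * q) s) (min (T * r) t) ×ˢ (D ∩ Icc 0 1)) =
        ξ (Ioc (max (T * q) s) (min (T * r) t) ×ˢ (D ∩ Icc 0 1)))
    (hfull : ∀ D : Set ℝ, MeasurableSet D →
      η (Ioc s t ×ˢ (D ∩ Icc 0 1)) = ξ (Ioc s t ×ˢ (D ∩ Icc 0 1))) :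
    η.restrict (Ioc s t ×ˢ Icc 0 1) = ξ.restrict (Ioc s t ×ˢ Icc 0 1) := by
  have : IsFiniteMeasure (η.restrict (Ioc s t ×ˢ Icc 0 1)) := ⟨by simpa using hη.lt_top⟩
  have : IsFiniteMeasure (ξ.restrict (Ioc s t ×ˢ Icc 0 1)) := ⟨by simpa using hξ.lt_top⟩
  have hset : ∀ A D : Set ℝ, A ×ˢ D ∩ Ioc s t ×ˢ Icc (0 : ℝ) 1 =
      (A ∩ Ioc s t) ×ˢ (D ∩ Icc 0 1) := fun A D => prod_inter_prod
  refine Measure.ext_prod fun {A D} hA hD => ?_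
  have hfst : ∀ {μ : Measure (ℝ × ℝ)} {B : Set ℝ}, MeasurableSet B →
      ((μ.restrict (Ioc s t ×ˢ Icc 0 1)).restrict (univ ×ˢ D)).map Prod.fst B =
      μ ((B ∩ Ioc s t) ×ˢ (D ∩ Icc 0 1)) := by
    intro μ B hB
    rw [Measure.map_apply measurable_fst hB, Measure.restrict_apply (measurable_fst hB),
      Measure.restrict_apply ((measurable_fst hB).inter (MeasurableSet.univ.prod hD)), ← hset]
    congr 1
    ext p
    simp only [mem_inter_iff, mem_preimage, mem_prod, mem_univ]
    tauto
  rw [Measure.restrict_apply (hA.prod hD), Measure.restrict_apply (hA.prod hD), hset,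
    ← hfst hA, ← hfst hA]
  congr 1
  have hdense : Dense (range fun q : ℚ => T * (q : ℝ)) :=
    (Homeomorph.mulLeft₀ T hT.ne').surjective.denseRange.comp Rat.denseRange_cast
      (Homeomorph.mulLeft₀ T hT.ne').continuous
  refine ext_of_generate_finite _
    ((BorelSpace.measurable_eq (α := ℝ)).trans hdense.borel_eq_generateFrom_Ioc_mem)
    (isPiSystem_Ioc_mem _ _) ?_ ?_
  · rintro _ ⟨_, ⟨q, rfl⟩, _, ⟨r, rfl⟩, -, rfl⟩
    rw [hfst measurableSet_Ioc, hfst measurableSet_Ioc, Ioc_inter_Ioc]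
    exact h q r D hD
  · rw [hfst MeasurableSet.univ, hfst MeasurableSet.univ, univ_inter]
    exact hfull D hD

theorem exists_rat_window {T : ℝ} (hT : 0 < T) {t δ : ℝ} (ht : t ∈ Ioc 0 T) (hδ : 0 < δ) :
    ∃ q r : ℚ, 0 < q ∧ r ≤ 1 ∧ t - δ < T * q ∧ T * q < t ∧ t ≤ T * r ∧ T * r < t + δ := by
  obtain ⟨q, hq1, hq2⟩ := exists_rat_btwn (show max 0 ((t - δ) / T) < t / T from
    max_lt (div_pos ht.1 hT) (by gcongr; linarith))
  obtain ⟨r, hr, hr1, hr2⟩ : ∃ r : ℚ, r ≤ 1 ∧ t ≤ T * r ∧ T * r < t + δ := by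
    rcases ht.2.eq_or_lt with h | h
    -- At the final time the window cannot extend to the right, and half-open intervals `(T q, T r]`
    -- still contain `t = T r`.
    · exact ⟨1, le_rfl, by simp [h], by simp [h, hδ]⟩
    · obtain ⟨r, h1, h2⟩ := exists_rat_btwn (show t / T < min 1 ((t + δ) / T) from
        lt_min ((div_lt_one hT).2 h) (by gcongr; linarith))
      rw [div_lt_iff₀' hT] at h1
      rw [lt_min_iff, lt_div_iff₀' hT] at h2
      exact ⟨r, by exact_mod_cast h2.1.le, h1.le, h2.2⟩
  rw [max_lt_iff, div_lt_iff₀' hT] at hq1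
  rw [lt_div_iff₀' hT] at hq2
  exact ⟨q, r, by exact_mod_cast hq1.1, hr, hq1.2, hq2, hr1, hr2⟩

theorem cosIntegral_zero (g : ℝ → ℝ) : cosIntegral 0 g = ∫ y in (0 : ℝ)..1, g y := by
  simp [cosIntegral]

theorem ae_eq_zero_of_contact {T : ℝ} {X : ℝ → ℝ → ℝ} {η : Measure (ℝ × ℝ)}
    (hX : ContinuousOn (fun p : ℝ × ℝ => X p.1 p.2) (Ioc 0 T ×ˢ Icc 0 1))
    (hnonneg : ∀ t ∈ Ioc 0 T, ∀ θ ∈ Icc (0 : ℝ) 1, 0 ≤ X t θ)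
    (hcontact : ∫⁻ p in Icc 0 T ×ˢ Icc 0 1, ENNReal.ofReal (X p.1 p.2) ∂η = 0) :
    ∀ᵐ p ∂(η.restrict (Ioc 0 T ×ˢ Icc 0 1)), X p.1 p.2 = 0 := by
  have hR : MeasurableSet (Ioc 0 T ×ˢ Icc (0 : ℝ) 1) := measurableSet_Ioc.prod measurableSet_Icc
  have h0 : ∫⁻ p in Ioc 0 T ×ˢ Icc 0 1, ENNReal.ofReal (X p.1 p.2) ∂η = 0 :=
    le_antisymm ((lintegral_mono_set (Set.prod_mono Ioc_subset_Icc_self Subset.rfl)).trans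
      hcontact.le) zero_le
  rw [lintegral_eq_zero_iff' (hX.aemeasurable hR).ennreal_ofReal] at h0
  filter_upwards [h0, ae_restrict_mem hR] with p hp hpR
  exact le_antisymm (ENNReal.ofReal_eq_zero.1 hp) (hnonneg p.1 hpR.1 p.2 hpR.2)

/-- The measures are compared locally in time. Around each `t`, positivity of the mean gives a
space-time box where `X > 0`, and this box is charged by neither measure. -/
theorem measure_eq_of_cos {T : ℝ} (hT : 0 < T) {X : ℝ → ℝ → ℝ}
    (hX : ContinuousOn (fun p : ℝ × ℝ => X p.1 p.2) (Ioc 0 T ×ˢ Icc 0 1))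
    (hmean : ∀ t ∈ Ioc 0 T, 0 < cosIntegral 0 (X t)) {η ξ : Measure (ℝ × ℝ)}
    (hηc : η (Ioc 0 T ×ˢ Icc 0 1)ᶜ = 0) (hξc : ξ (Ioc 0 T ×ˢ Icc 0 1)ᶜ = 0)
    (hη : ∀ δ ∈ Ioc 0 T, η (Icc δ T ×ˢ Icc 0 1) < ∞)
    (hξ : ∀ δ ∈ Ioc 0 T, ξ (Icc δ T ×ˢ Icc 0 1) < ∞)
    (hXη : ∀ᵐ p ∂(η.restrict (Ioc 0 T ×ˢ Icc 0 1)), X p.1 p.2 = 0)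
    (hXξ : ∀ᵐ p ∂(ξ.restrict (Ioc 0 T ×ˢ Icc 0 1)), X p.1 p.2 = 0)
    (hcos : ∀ q r : ℚ, 0 < q → q ≤ r → r ≤ 1 → ∀ k : ℕ, k ≠ 0 →
      ∫ p in Ioc (T * q) (T * r) ×ˢ Icc 0 1, Real.cos (k * Real.pi * p.2) ∂η =
      ∫ p in Ioc (T * q) (T * r) ×ˢ Icc 0 1, Real.cos (k * Real.pi * p.2) ∂ξ) :
    η = ξ := by
  have hR : MeasurableSet (Ioc 0 T ×ˢ Icc (0 : ℝ) 1) := measurableSet_Ioc.prod measurableSet_Icc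
  have hloc : ∀ t ∈ Ioc 0 T, ∃ q r : ℚ, t ∈ Ioc (T * q) (T * r) ∧
      η.restrict (Ioc (T * q) (T * r) ×ˢ Icc 0 1) =
        ξ.restrict (Ioc (T * q) (T * r) ×ˢ Icc 0 1) := by
    intro t ht
    obtain ⟨θ₀, hθ₀, hpos⟩ : ∃ θ ∈ Icc (0 : ℝ) 1, 0 < X t θ := by
      by_contra! h
      have := hmean t ht
      rw [cosIntegral_zero] at this
      have h2 : 0 ≤ ∫ y in (0 : ℝ)..1, -X t y :=
        intervalIntegral.integral_nonneg zero_le_one fun y hy => neg_nonneg.2 (h y hy)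
      rw [intervalIntegral.integral_neg] at h2
      linarith
    obtain ⟨δ, hδ, hXδ⟩ := Metric.continuousWithinAt_iff.1 (hX (t, θ₀) ⟨ht, hθ₀⟩) _ hpos
    obtain ⟨q, r, hq, hr, h1, h2, h3, h4⟩ := exists_rat_window hT ht hδ
    have hfin : ∀ {μ : Measure (ℝ × ℝ)}, (∀ δ ∈ Ioc 0 T, μ (Icc δ T ×ˢ Icc 0 1) < ∞) →
        ∀ q' r' : ℚ, 0 < q' → r' ≤ 1 → μ (Ioc (T * q') (T * r') ×ˢ Icc 0 1) ≠ ∞ := by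
      intro μ hμ q' r' hq' hr'
      have hr'' : T * (r' : ℝ) ≤ T := mul_le_of_le_one_right hT.le (by exact_mod_cast hr')
      have hq'' : 0 < T * (q' : ℝ) := mul_pos hT (by exact_mod_cast hq')
      rcases lt_or_ge T (T * q') with h | h
      · rw [Ioc_eq_empty (not_lt.2 (hr''.trans h.le))]
        simp
      · refine ((measure_mono (Set.prod_mono ?_ Subset.rfl)).trans_lt (hμ (T * q') ⟨hq'', h⟩)).ne
        exact fun x hx => ⟨hx.1.le, hx.2.trans hr''⟩
    -- A tent of radius `δ` around `θ₀`: within the window `(T q, T r]`, `X` is positive wherever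
    -- `g` is nonzero, while the measures are carried by `X = 0`.
    set g : ℝ → ℝ := fun θ => max 0 (δ - |θ - θ₀|) with hgdef
    have hg : ContinuousOn g (Icc 0 1) := by fun_prop
    have hg0 : cosIntegral 0 g ≠ 0 := by
      rw [cosIntegral_zero]
      refine (intervalIntegral.integral_pos zero_lt_one hg (fun y _ => le_max_left _ _)
        ⟨θ₀, hθ₀, ?_⟩).ne'
      simpa [hgdef] using hδ
    have hgz : ∀ {μ : Measure (ℝ × ℝ)},
        (∀ᵐ p ∂(μ.restrict (Ioc 0 T ×ˢ Icc 0 1)), X p.1 p.2 = 0) →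
        ∀ q' r' : ℚ, q ≤ q' → r' ≤ r →
        ∫ p in Ioc (T * q') (T * r') ×ˢ Icc 0 1, g p.2 ∂μ = 0 := by
      intro μ hμ q' r' hq' hr'
      have a1 : T * (q : ℝ) ≤ T * q' := by gcongr
      have a2 : T * (r' : ℝ) ≤ T * r := by gcongr
      have a3 : T * (r : ℝ) ≤ T := mul_le_of_le_one_right hT.le (by exact_mod_cast hr)
      have a4 : 0 < T * (q : ℝ) := mul_pos hT (by exact_mod_cast hq)
      have hsub : Ioc (T * (q' : ℝ)) (T * r') ×ˢ Icc (0 : ℝ) 1 ⊆ Ioc 0 T ×ˢ Icc 0 1 :=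
        Set.prod_mono (Ioc_subset_Ioc (by linarith) (by linarith)) Subset.rfl
      refine integral_eq_zero_of_ae ?_
      filter_upwards [ae_mono (Measure.restrict_mono_set _ hsub) hμ,
        ae_restrict_mem (measurableSet_Ioc.prod measurableSet_Icc)] with p hp hpm
      by_contra hne
      have hlt : |p.2 - θ₀| < δ := by
        by_contra! h
        exact hne (max_eq_left (by linarith))
      have hp1 : T * (q' : ℝ) < p.1 ∧ p.1 ≤ T * r' := hpm.1
      have := hXδ (hsub hpm) (by
        rw [Prod.dist_eq, max_lt_iff, Real.dist_eq, Real.dist_eq]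
        refine ⟨?_, hlt⟩
        rw [abs_lt]
        constructor <;> simp only <;> linarith)
      rw [hp, Real.dist_eq, zero_sub, abs_neg, abs_of_pos hpos] at this
      exact lt_irrefl _ this
    have hsubrect : ∀ q' r' : ℚ, q ≤ q' → r' ≤ r → ∀ D : Set ℝ, MeasurableSet D →
        η (Ioc (T * q') (T * r') ×ˢ (D ∩ Icc 0 1)) =
          ξ (Ioc (T * q') (T * r') ×ˢ (D ∩ Icc 0 1)) := by
      intro q' r' hq' hr' D hD
      rcases lt_or_ge r' q' with h | h
      · have : T * (r' : ℝ) ≤ T * q' := by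
          have : (r' : ℝ) ≤ q' := by exact_mod_cast h.le
          gcongr
        simp [Ioc_eq_empty (not_lt.2 this)]
      · exact measure_prod_eq_of_cos (hfin hη q' r' (hq.trans_le hq') (hr'.trans hr))
          (hfin hξ q' r' (hq.trans_le hq') (hr'.trans hr))
          (hcos q' r' (hq.trans_le hq') h (hr'.trans hr)) hg hg0
          (hgz hXη q' r' hq' hr') (hgz hXξ q' r' hq' hr') hD
    refine ⟨q, r, ⟨h2, h3⟩, restrict_eq_of_Ioc_prod hT (hfin hη q r hq hr) (hfin hξ q r hq hr)
      (fun q' r' D hD => ?_) (hsubrect q r le_rfl le_rfl)⟩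
    have e1 : max (T * (q' : ℝ)) (T * q) = T * (max q' q : ℚ) := by
      rw [Rat.cast_max, mul_max_of_nonneg _ _ hT.le]
    have e2 : min (T * (r' : ℝ)) (T * r) = T * (min r' r : ℚ) := by
      rw [Rat.cast_min, mul_min_of_nonneg _ _ hT.le]
    rw [e1, e2]
    exact hsubrect _ _ (le_max_right _ _) (min_le_right _ _) D hD
  -- A countable cover of the plane: the rational strips where the measures agree, and, as `none`,
  -- the complement of the carrier.
  let S : Option {z : ℚ × ℚ // η.restrict (Ioc (T * z.1) (T * z.2) ×ˢ Icc 0 1) =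
      ξ.restrict (Ioc (T * z.1) (T * z.2) ×ˢ Icc 0 1)} → Set (ℝ × ℝ) := fun o =>
    o.elim (Ioc 0 T ×ˢ Icc 0 1)ᶜ fun z => Ioc (T * z.1.1) (T * z.1.2) ×ˢ Icc 0 1
  refine (Measure.ext_iff_of_iUnion_eq_univ (s := S) ?_).2 ?_
  · refine eq_univ_of_forall fun p => ?_
    by_cases hp : p ∈ Ioc 0 T ×ˢ Icc (0 : ℝ) 1
    · obtain ⟨q, r, hqr, he⟩ := hloc p.1 hp.1
      exact mem_iUnion.2 ⟨some ⟨(q, r), he⟩, hqr, hp.2⟩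
    · exact mem_iUnion.2 ⟨none, hp⟩
  · rintro (_ | z)
    · change η.restrict (Ioc 0 T ×ˢ Icc 0 1)ᶜ = ξ.restrict (Ioc 0 T ×ˢ Icc 0 1)ᶜ
      rw [Measure.restrict_eq_zero.2 hηc, Measure.restrict_eq_zero.2 hξc]
    · exact z.2

/-! ### Cosine test functions -/

theorem isWeakDeriv_of_hasDerivAt {u v : ℝ → ℝ} (hu : ∀ θ, HasDerivAt u (v θ) θ)
    (hv : Continuous v) : IsWeakDeriv u v := by
  intro φ hφ _ hsupp
  have h0 : φ 0 = 0 := image_eq_zero_of_notMem_tsupport fun h => lt_irrefl _ (hsupp h).1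
  have h1 : φ 1 = 0 := image_eq_zero_of_notMem_tsupport fun h => lt_irrefl _ (hsupp h).2
  rw [intervalIntegral.integral_mul_deriv_eq_deriv_mul (u' := v) (fun θ _ => hu θ)
    (fun θ _ => (hφ.differentiable (by simp) θ).hasDerivAt) (hv.intervalIntegrable _ _)
    ((hφ.continuous_deriv (by simp)).intervalIntegrable _ _), h0, h1]
  ring

/-- With a free amplitude `c`, the Laplacian has the same form as the function itself, so two
applications show that cosines lie in `D(A²)`. -/
theorem isNeumannLaplacian_cos (c : ℝ) (k : ℕ) :
    IsNeumannLaplacian (fun θ => c * Real.cos (k * Real.pi * θ))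
      (fun θ => -(c * (k * Real.pi)) * Real.sin (k * Real.pi * θ))
      (fun θ => -(c * (k * Real.pi) ^ 2) * Real.cos (k * Real.pi * θ)) where
  continuousOn := by fun_prop
  continuousOn_deriv := by fun_prop
  memLp := memLp_of_continuousOn (by fun_prop)
  weakDeriv := isWeakDeriv_of_hasDerivAt (fun θ => by
    have := (((hasDerivAt_id θ).const_mul (k * Real.pi)).cos).const_mul c
    refine this.congr_deriv ?_
    simp only [id]
    ring) (by fun_prop)
  weakDeriv_deriv := isWeakDeriv_of_hasDerivAt (fun θ => by
    have := (((hasDerivAt_id θ).const_mul (k * Real.pi)).sin).const_mul (-(c * (k * Real.pi)))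
    refine this.congr_deriv ?_
    simp only [id]
    ring) (by fun_prop)
  deriv_zero := by simp
  deriv_one := by simp [Real.sin_nat_mul_pi]

/-! ### The norm of `V_{-1}` and cosine coefficients -/

theorem abs_cosIntegral_le {g : ℝ → ℝ} {M : ℝ} (hM : ∀ y ∈ Icc (0 : ℝ) 1, |g y| ≤ M) (k : ℕ) :
    |cosIntegral k g| ≤ M := by
  have := intervalIntegral.norm_integral_le_of_norm_le_const (a := (0 : ℝ)) (b := 1) (C := M)
    (f := fun y => g y * Real.cos (k * Real.pi * y)) (fun y hy => by
      rw [uIoc_of_le zero_le_one] at hy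
      rw [norm_mul, Real.norm_eq_abs, Real.norm_eq_abs]
      have h1 := hM y (Ioc_subset_Icc_self hy)
      exact (mul_le_of_le_one_right (abs_nonneg _) (Real.abs_cos_le_one _)).trans h1)
  simpa [cosIntegral] using this

theorem cosCoeff_sq (g : ℝ → ℝ) (k : ℕ) : cosCoeff g k ^ 2 = 2 * cosIntegral k g ^ 2 := by
  have : cosCoeff g k = √2 * cosIntegral k g := by
    rw [cosCoeff, cosIntegral, ← intervalIntegral.integral_const_mul]
    refine intervalIntegral.integral_congr fun y _ => ?_
    ring
  rw [this, mul_pow, Real.sq_sqrt zero_le_two]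

theorem normVNegOne_sq (g : ℝ → ℝ) : normVNegOne g ^ 2 =
    (∑' i : ℕ, (((i + 1 : ℕ) * Real.pi) ^ 2)⁻¹ * cosCoeff g (i + 1) ^ 2) + mean g ^ 2 :=
  Real.sq_sqrt (add_nonneg (tsum_nonneg fun _ => by positivity) (sq_nonneg _))

theorem cosIntegral_zero_sq_le (g : ℝ → ℝ) : cosIntegral 0 g ^ 2 ≤ normVNegOne g ^ 2 := by
  rw [normVNegOne_sq, cosIntegral_zero]
  exact le_add_of_nonneg_left (tsum_nonneg fun _ => by positivity)

theorem sum_inv_mul_cosIntegral_sq_le {g : ℝ → ℝ} (hg : ContinuousOn g (Icc 0 1)) (N : ℕ) :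
    ∑ k ∈ Finset.range N, ((k * Real.pi) ^ 2)⁻¹ * cosIntegral k g ^ 2 ≤ normVNegOne g ^ 2 := by
  obtain ⟨M, hM⟩ := isCompact_Icc.exists_bound_of_continuousOn hg
  -- Summability is needed because a divergent `tsum` would be `0` and bound nothing. It holds since
  -- the coefficients of a bounded function are bounded.
  have hsum : Summable fun i : ℕ =>
      (((i + 1 : ℕ) * Real.pi) ^ 2)⁻¹ * cosCoeff g (i + 1) ^ 2 := by
    have h1 : Summable fun i : ℕ => (((i + 1 : ℕ) : ℝ) ^ 2)⁻¹ :=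
      (summable_nat_add_iff 1).2 (Real.summable_nat_pow_inv.2 one_lt_two)
    refine Summable.of_nonneg_of_le (fun _ => by positivity) (fun i => ?_)
      (h1.mul_right ((Real.pi ^ 2)⁻¹ * (2 * M ^ 2)))
    rw [mul_pow, mul_inv, mul_assoc, cosCoeff_sq]
    have h2 := abs_cosIntegral_le hM (i + 1)
    have h3 : cosIntegral (i + 1) g ^ 2 ≤ M ^ 2 := sq_le_sq' (abs_le.1 h2).1 (abs_le.1 h2).2
    gcongr
  have h4 : ∑ k ∈ Finset.range (N + 1), ((k * Real.pi) ^ 2)⁻¹ * cosIntegral k g ^ 2 ≤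
      ∑ i ∈ Finset.range N, (((i + 1 : ℕ) * Real.pi) ^ 2)⁻¹ * cosCoeff g (i + 1) ^ 2 := by
    rw [Finset.sum_range_succ']
    simp only [Nat.cast_zero, zero_mul, ne_eq, OfNat.ofNat_ne_zero, not_false_eq_true, zero_pow,
      inv_zero, add_zero]
    refine Finset.sum_le_sum fun i _ => ?_
    rw [cosCoeff_sq]
    have : 0 ≤ cosIntegral (i + 1) g ^ 2 := sq_nonneg _
    gcongr
    linarith
  have h5 : ∑ k ∈ Finset.range N, ((k * Real.pi) ^ 2)⁻¹ * cosIntegral k g ^ 2 ≤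
      ∑ k ∈ Finset.range (N + 1), ((k * Real.pi) ^ 2)⁻¹ * cosIntegral k g ^ 2 := by
    rw [Finset.sum_range_succ]
    exact le_add_of_nonneg_right (by positivity)
  have h6 := hsum.sum_le_tsum (Finset.range N) (fun _ _ => by positivity)
  rw [normVNegOne_sq]
  have := sq_nonneg (mean g)
  linarith

theorem cosIntegral_sub {g h : ℝ → ℝ} (hg : ContinuousOn g (Icc 0 1))
    (hh : ContinuousOn h (Icc 0 1)) (k : ℕ) :
    cosIntegral k (fun θ => g θ - h θ) = cosIntegral k g - cosIntegral k h := by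
  have hi : ∀ {g : ℝ → ℝ}, ContinuousOn g (Icc 0 1) →
      IntervalIntegrable (fun y => g y * Real.cos (k * Real.pi * y)) volume 0 1 := by
    intro g hg
    refine ContinuousOn.intervalIntegrable ?_
    rw [uIcc_of_le zero_le_one]
    fun_prop
  unfold cosIntegral
  rw [← intervalIntegral.integral_sub (hi hg) (hi hh)]
  simp_rw [sub_mul]

theorem cosIntegral_congr {g h : ℝ → ℝ} (hgh : ∀ θ ∈ Icc (0 : ℝ) 1, g θ = h θ) (k : ℕ) :
    cosIntegral k g = cosIntegral k h := by
  refine intervalIntegral.integral_congr fun y hy => ?_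
  rw [uIcc_of_le zero_le_one] at hy
  simp only [hgh y hy]

/-! ### The equation for one path -/

theorem intervalIntegral_eq_setIntegral_prod {G : ℝ × ℝ → ℝ} {s t : ℝ} (hst : s ≤ t)
    (hG : IntegrableOn G (Ioc s t ×ˢ Icc 0 1)) :
    ∫ r in s..t, ∫ θ in (0 : ℝ)..1, G (r, θ) = ∫ p in Ioc s t ×ˢ Icc 0 1, G p := by
  rw [Measure.volume_eq_prod] at hG ⊢
  rw [setIntegral_prod _ hG, intervalIntegral.integral_of_le hst]
  refine setIntegral_congr_fun measurableSet_Ioc fun r _ => ?_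
  rw [integral_Icc_eq_integral_Ioc, intervalIntegral.integral_of_le zero_le_one]

/-- The increment over `[s,t]` of the coefficient of order `k` of a solution `X` with reflection
measure `η`, nonlinearity `F` and noise `n`. -/
def CosEquation (κ : ℝ) (F : ℝ → ℝ) (X : ℝ → ℝ → ℝ) (η : Measure (ℝ × ℝ)) (n : ℕ → ℝ → ℝ) (k : ℕ)
    (s t : ℝ) : Prop :=
  cosIntegral k (X t) - cosIntegral k (X s) =
    (∫ p in Ioc s t ×ˢ Icc 0 1, Real.cos (k * Real.pi * p.2) *
      (κ * (k * Real.pi) ^ 2 * F (X p.1 p.2) - κ * (k * Real.pi) ^ 4 * X p.1 p.2)) +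
    (∫ p in Ioc s t ×ˢ Icc 0 1, κ * (k * Real.pi) ^ 2 * Real.cos (k * Real.pi * p.2) ∂η) -
    (n k t - n k s)

/-- The properties of a single path of a weak solution, tested against cosines at the rational
multiples of `T`. -/
structure IsPathSolution (κ T : ℝ) (F : ℝ → ℝ) (x : ℝ → ℝ) (X : ℝ → ℝ → ℝ)
    (η : Measure (ℝ × ℝ)) (n : ℕ → ℝ → ℝ) : Prop where
  continuousOn : ContinuousOn (fun p : ℝ × ℝ => X p.1 p.2) (Ioc 0 T ×ˢ Icc 0 1)
  nonneg : ∀ t ∈ Ioc 0 T, ∀ θ ∈ Icc (0 : ℝ) 1, 0 ≤ X t θ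
  continuous_VNegOne : ContinuousInVNegOne T X
  initial : ∀ θ ∈ Icc (0 : ℝ) 1, X 0 θ = x θ
  carrier : η (Ioc 0 T ×ˢ Icc 0 1)ᶜ = 0
  finite : ∀ δ ∈ Ioc 0 T, η (Icc δ T ×ˢ Icc 0 1) < ∞
  pos : ∀ᵐ p : ℝ × ℝ ∂(volume.restrict (Icc 0 T ×ˢ Icc 0 1)), 0 < X p.1 p.2
  integrable : IntegrableOn (fun p : ℝ × ℝ => F (X p.1 p.2)) (Icc 0 T ×ˢ Icc 0 1)
  equation : ∀ (k : ℕ) (q r : ℚ), 0 < q → q ≤ r → r ≤ 1 → CosEquation κ F X η n k (T * q) (T * r)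
  contact : ∫⁻ p in Icc 0 T ×ˢ Icc 0 1, ENNReal.ofReal (X p.1 p.2) ∂η = 0

/-- Subtracting the equations on `[δ, s]` and `[δ, t]` turns the closed time intervals in the `η`
integrals into the half-open `(s, t]`, which is additive under subdivision even if `η` charges a
time slice. -/
theorem cosEquation_of_equation {κ T : ℝ} {F : ℝ → ℝ} {X : ℝ → ℝ → ℝ} {η : Measure (ℝ × ℝ)}
    {n : ℕ → ℝ → ℝ} {k : ℕ}
    (hX : ContinuousOn (fun p : ℝ × ℝ => X p.1 p.2) (Ioc 0 T ×ˢ Icc 0 1))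
    (hF : IntegrableOn (fun p : ℝ × ℝ => F (X p.1 p.2)) (Icc 0 T ×ˢ Icc 0 1))
    {δ s t : ℝ} (hδ : 0 < δ) (hδs : δ ≤ s) (hst : s ≤ t) (htT : t ≤ T)
    (hη : η (Icc δ t ×ˢ Icc 0 1) ≠ ∞)
    (h : ∀ r, r = s ∨ r = t →
      ∫ θ in (0 : ℝ)..1, X r θ * (1 * Real.cos (k * Real.pi * θ)) =
        (∫ θ in (0 : ℝ)..1, X δ θ * (1 * Real.cos (k * Real.pi * θ)))
        - κ * (∫ s in δ..r, ∫ θ in (0 : ℝ)..1, X s θ *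
          (-(-(1 * (k * Real.pi) ^ 2) * (k * Real.pi) ^ 2) * Real.cos (k * Real.pi * θ)))
        - κ * (∫ s in δ..r, ∫ θ in (0 : ℝ)..1,
          -(1 * (k * Real.pi) ^ 2) * Real.cos (k * Real.pi * θ) * F (X s θ))
        - κ * (∫ p in Icc δ r ×ˢ Icc 0 1, -(1 * (k * Real.pi) ^ 2) * Real.cos (k * Real.pi * p.2) ∂η)
        - (n k r - n k δ)) :
    CosEquation κ F X η n k s t := by
  have hI : MeasurableSet (Icc (0 : ℝ) 1) := measurableSet_Icc
  have hFi : IntegrableOn (fun p : ℝ × ℝ => F (X p.1 p.2)) (Ioc δ t ×ˢ Icc 0 1) :=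
    hF.mono_set (Set.prod_mono (fun r hr => ⟨hδ.le.trans hr.1.le, hr.2.trans htT⟩) Subset.rfl)
  have hXi : IntegrableOn (fun p : ℝ × ℝ => X p.1 p.2) (Ioc δ t ×ˢ Icc 0 1) :=
    ((hX.mono (Set.prod_mono (fun r hr => ⟨hδ.trans_le hr.1, hr.2.trans htT⟩)
      Subset.rfl)).integrableOn_compact ((isCompact_Icc (a := δ) (b := t)).prod
        isCompact_Icc)).mono_set (Set.prod_mono Ioc_subset_Icc_self Subset.rfl)
  have hcF := integrableOn_cos_mul hFi (k * Real.pi)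
  have hcX := integrableOn_cos_mul hXi (k * Real.pi)
  have hφ : IntegrableOn (fun p : ℝ × ℝ => Real.cos (k * Real.pi * p.2) *
      (κ * (k * Real.pi) ^ 2 * F (X p.1 p.2) - κ * (k * Real.pi) ^ 4 * X p.1 p.2))
      (Ioc δ t ×ˢ Icc 0 1) := by
    refine ((hcF.const_mul (κ * (k * Real.pi) ^ 2)).sub
      (hcX.const_mul (κ * (k * Real.pi) ^ 4))).congr (Eventually.of_forall fun p => ?_)
    simp only [Pi.sub_apply]
    ring
  have hψ : IntegrableOn (fun p : ℝ × ℝ => κ * (k * Real.pi) ^ 2 * Real.cos (k * Real.pi * p.2))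
      (Icc δ t ×ˢ Icc 0 1) η := by
    have := (integrableOn_cos_mul (integrableOn_const (C := (1 : ℝ)) hη) (k * Real.pi)).const_mul
      (κ * (k * Real.pi) ^ 2)
    simp only [mul_one] at this
    exact this
  have key : ∀ r, r = s ∨ r = t → cosIntegral k (X r) = cosIntegral k (X δ) +
      (∫ p in Ioc δ r ×ˢ Icc 0 1, Real.cos (k * Real.pi * p.2) *
      (κ * (k * Real.pi) ^ 2 * F (X p.1 p.2) - κ * (k * Real.pi) ^ 4 * X p.1 p.2)) +
      (∫ p in Icc δ r ×ˢ Icc 0 1, κ * (k * Real.pi) ^ 2 * Real.cos (k * Real.pi * p.2) ∂η) -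
      (n k r - n k δ) := by
    intro r hr
    have hδr : δ ≤ r := by rcases hr with rfl | rfl <;> linarith
    have hrt : r ≤ t := by rcases hr with rfl | rfl <;> linarith
    have hsub : Ioc δ r ×ˢ Icc (0 : ℝ) 1 ⊆ Ioc δ t ×ˢ Icc 0 1 :=
      Set.prod_mono (Ioc_subset_Ioc_right hrt) Subset.rfl
    have e := h r hr
    simp only [one_mul] at e
    have i1 : ∫ s in δ..r, ∫ θ in (0 : ℝ)..1, X s θ *
          (-(-((k * Real.pi) ^ 2) * (k * Real.pi) ^ 2) * Real.cos (k * Real.pi * θ)) =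
        (k * Real.pi) ^ 4 * ∫ p in Ioc δ r ×ˢ Icc 0 1, Real.cos (k * Real.pi * p.2) * X p.1 p.2 := by
      rw [← integral_const_mul,
        ← intervalIntegral_eq_setIntegral_prod hδr ((hcX.mono_set hsub).const_mul _)]
      congr 1
      ext s
      congr 1
      ext θ
      ring
    have i2 : ∫ s in δ..r, ∫ θ in (0 : ℝ)..1,
          -((k * Real.pi) ^ 2) * Real.cos (k * Real.pi * θ) * F (X s θ) =
        -(k * Real.pi) ^ 2 * ∫ p in Ioc δ r ×ˢ Icc 0 1,
          Real.cos (k * Real.pi * p.2) * F (X p.1 p.2) := by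
      rw [← integral_const_mul,
        ← intervalIntegral_eq_setIntegral_prod hδr ((hcF.mono_set hsub).const_mul _)]
      congr 1
      ext s
      congr 1
      ext θ
      ring
    have i3 : ∫ p in Icc δ r ×ˢ Icc 0 1, -((k * Real.pi) ^ 2) * Real.cos (k * Real.pi * p.2) ∂η =
        -(k * Real.pi) ^ 2 * ∫ p in Icc δ r ×ˢ Icc 0 1, Real.cos (k * Real.pi * p.2) ∂η :=
      integral_const_mul _ _
    have i4 : ∫ p in Ioc δ r ×ˢ Icc 0 1, Real.cos (k * Real.pi * p.2) *
        (κ * (k * Real.pi) ^ 2 * F (X p.1 p.2) - κ * (k * Real.pi) ^ 4 * X p.1 p.2) =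
        κ * (k * Real.pi) ^ 2 * (∫ p in Ioc δ r ×ˢ Icc 0 1,
          Real.cos (k * Real.pi * p.2) * F (X p.1 p.2)) -
        κ * (k * Real.pi) ^ 4 * ∫ p in Ioc δ r ×ˢ Icc 0 1,
          Real.cos (k * Real.pi * p.2) * X p.1 p.2 := by
      rw [← integral_const_mul, ← integral_const_mul, ← integral_sub
        ((hcF.mono_set hsub).const_mul _) ((hcX.mono_set hsub).const_mul _)]
      congr 1
      ext p
      ring
    rw [i1, i2, i3] at e
    rw [i4, integral_const_mul, cosIntegral, e, cosIntegral]
    ring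
  have hs := key s (Or.inl rfl)
  have ht := key t (Or.inr rfl)
  have hU : Ioc δ t ×ˢ Icc (0 : ℝ) 1 = Ioc δ s ×ˢ Icc 0 1 ∪ Ioc s t ×ˢ Icc 0 1 := by
    rw [← union_prod, Ioc_union_Ioc_eq_Ioc hδs hst]
  have hU' : Icc δ t ×ˢ Icc (0 : ℝ) 1 = Icc δ s ×ˢ Icc 0 1 ∪ Ioc s t ×ˢ Icc 0 1 := by
    rw [← union_prod, Icc_union_Ioc_eq_Icc hδs hst]
  rw [hU] at ht hφ
  rw [hU'] at ht hψ
  rw [setIntegral_union (Set.disjoint_prod.2 (Or.inl (Set.disjoint_left.2 fun x hx hx' =>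
      absurd hx.2 (not_le.2 hx'.1)))) (measurableSet_Ioc.prod hI)
      (hφ.mono_set subset_union_left) (hφ.mono_set subset_union_right),
    setIntegral_union (Set.disjoint_prod.2 (Or.inl (Set.disjoint_left.2 fun x hx hx' =>
      absurd hx.2 (not_le.2 hx'.1)))) (measurableSet_Ioc.prod hI)
      (hψ.mono_set subset_union_left) (hψ.mono_set subset_union_right)] at ht
  rw [CosEquation, ht, hs]
  ring

/-! ### Uniqueness for a fixed realization of the noise -/

theorem eq_of_eq_rat {T : ℝ} (hT : 0 < T) {G : ℝ → ℝ} (hG : ContinuousOn G (Ioc 0 T)) {c : ℝ}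
    (h : ∀ r : ℚ, 0 < r → r ≤ 1 → G (T * r) = c) {t : ℝ} (ht : t ∈ Ioc 0 T) : G t = c := by
  by_contra hne
  obtain ⟨δ, hδ, hGδ⟩ := Metric.continuousWithinAt_iff.1 (hG t ht) _ (dist_pos.2 hne)
  obtain ⟨_, r, _, hr, _, _, h3, h4⟩ := exists_rat_window hT ht hδ
  have hr0 : (0 : ℝ) < r := pos_of_mul_pos_right (ht.1.trans_le h3) hT.le
  have := hGδ (x := T * r) ⟨ht.1.trans_le h3, mul_le_of_le_one_right hT.le (by exact_mod_cast hr)⟩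
    (by rw [Real.dist_eq, abs_lt]; constructor <;> linarith)
  rw [h r (by exact_mod_cast hr0) hr, dist_comm] at this
  exact lt_irrefl _ this

theorem continuousOn_cosIntegral_Ioc {X : ℝ → ℝ → ℝ} {T : ℝ}
    (hX : ContinuousOn (fun p : ℝ × ℝ => X p.1 p.2) (Ioc 0 T ×ˢ Icc 0 1)) (k : ℕ) :
    ContinuousOn (fun t => cosIntegral k (X t)) (Ioc 0 T) := by
  intro t ht
  have h := continuousOn_cosIntegral (a := t / 2) (b := T) (hX.mono
    (Set.prod_mono (fun s hs => ⟨(half_pos ht.1).trans_le hs.1, hs.2⟩) Subset.rfl)) k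
  refine (h t ⟨(half_lt_self ht.1).le, ht.2⟩).mono_of_mem_nhdsWithin ?_
  filter_upwards [self_mem_nhdsWithin,
    mem_nhdsWithin_of_mem_nhds (Ioi_mem_nhds (half_lt_self ht.1))] with s hs hs'
  exact ⟨le_of_lt hs', hs.2⟩

namespace IsPathSolution

variable {κ T : ℝ} {F : ℝ → ℝ} {x : ℝ → ℝ} {X Y : ℝ → ℝ → ℝ} {η ξ : Measure (ℝ × ℝ)}
  {n : ℕ → ℝ → ℝ}

theorem tendsto_normVNegOne (hX : IsPathSolution κ T F x X η n) (hT : 0 < T) {r : ℝ}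
    (hr1 : r ≤ 1) (hr0 : 0 ≤ r) :
    Tendsto (fun m : ℕ => normVNegOne (fun θ => X (T * (r / (m + 2))) θ - X 0 θ)) atTop
      (𝓝 0) := by
  refine (hX.continuous_VNegOne 0 ⟨le_rfl, hT.le⟩).comp (tendsto_nhdsWithin_iff.2 ⟨?_, ?_⟩)
  · have h : Tendsto (fun m : ℕ => r / ((m : ℝ) + 2)) atTop (𝓝 0) :=
      tendsto_const_nhds.div_atTop (tendsto_natCast_atTop_atTop.atTop_add tendsto_const_nhds)
    simpa using h.const_mul T
  · refine Eventually.of_forall fun m => ⟨by positivity, mul_le_of_le_one_right hT.le ?_⟩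
    have : (0 : ℝ) ≤ m := m.cast_nonneg
    rw [div_le_one (by positivity)]
    linarith

theorem continuousOn_apply (hX : IsPathSolution κ T F x X η n) (hx : ContinuousOn x (Icc 0 1))
    {t : ℝ} (ht : t ∈ Icc 0 T) : ContinuousOn (X t) (Icc 0 1) := by
  rcases ht.1.eq_or_lt with h | h
  · rw [← h]
    exact hx.congr hX.initial
  · exact continuousOn_section hX.continuousOn ⟨h, ht.2⟩

theorem mul_rat_mem_Ioc (hT : 0 < T) {r : ℚ} (hr0 : 0 < r) (hr1 : r ≤ 1) : T * (r : ℝ) ∈ Ioc 0 T :=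
  ⟨mul_pos hT (by exact_mod_cast hr0), mul_le_of_le_one_right hT.le (by exact_mod_cast hr1)⟩

/-- The shift by `2` keeps the starting times `T r/(m + 2)` strictly below `T r` for every `m`,
including `m = 0`. -/
theorem div_pos_and_lt {r : ℚ} (hr0 : 0 < r) (m : ℕ) : 0 < r / (m + 2) ∧ r / (m + 2) < r := by
  have : (0 : ℚ) ≤ m := m.cast_nonneg
  exact ⟨by positivity, div_lt_self hr0 (by linarith)⟩

/-- The mass of a solution is conserved. -/
theorem cosIntegral_zero_eq (hX : IsPathSolution κ T F x X η n) (hT : 0 < T)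
    (hx : ContinuousOn x (Icc 0 1)) (hn : ∀ r : ℚ, 0 < r → r ≤ 1 → n 0 (T * r) = 0) {t : ℝ}
    (ht : t ∈ Ioc 0 T) : cosIntegral 0 (X t) = mean x := by
  refine eq_of_eq_rat hT (continuousOn_cosIntegral_Ioc hX.continuousOn 0) (fun r hr0 hr1 => ?_) ht
  have hx0 : mean x = cosIntegral 0 (X 0) := by
    rw [cosIntegral_congr hX.initial, cosIntegral_zero, mean]
  have hle : ∀ m : ℕ, (cosIntegral 0 (X (T * r)) - mean x) ^ 2 ≤
      normVNegOne (fun θ => X (T * (r / (m + 2))) θ - X 0 θ) ^ 2 := by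
    intro m
    obtain ⟨h1, h2⟩ := div_pos_and_lt hr0 m
    -- For the constant mode every term of the equation carries a factor `0`, so the mean at `T r`
    -- equals that at a time tending to `0`, where `V_{-1}` continuity compares it with `x`.
    have h3 := hX.equation 0 _ _ h1 h2.le hr1
    rw [CosEquation, hn r hr0 hr1, hn _ h1 (h2.le.trans hr1)] at h3
    simp only [Nat.cast_zero, zero_mul, ne_eq, OfNat.ofNat_ne_zero, not_false_eq_true, zero_pow,
      mul_zero, sub_zero, integral_zero, add_zero, sub_eq_zero] at h3
    have hm := mul_rat_mem_Ioc hT h1 (h2.le.trans hr1)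
    push_cast at h3 hm
    rw [h3, hx0, ← cosIntegral_sub (hX.continuousOn_apply hx ⟨hm.1.le, hm.2⟩)
      (hX.continuousOn_apply hx ⟨le_rfl, hT.le⟩)]
    exact cosIntegral_zero_sq_le _
  have hlim := (hX.tendsto_normVNegOne hT (r := r) (by exact_mod_cast hr1)
    (by exact_mod_cast hr0.le)).pow 2
  have h0 := ge_of_tendsto' hlim hle
  have h1 : (cosIntegral 0 (X (T * r)) - mean x) ^ 2 = 0 :=
    le_antisymm (by simpa using h0) (sq_nonneg _)
  exact sub_eq_zero.1 (pow_eq_zero_iff two_ne_zero |>.1 h1)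

theorem measure_Ioc_ne_top (hX : IsPathSolution κ T F x X η n) {s t : ℝ} (hs : 0 < s)
    (ht : t ≤ T) : η (Ioc s t ×ˢ Icc 0 1) ≠ ∞ := by
  rcases lt_or_ge T s with h | h
  · rw [Ioc_eq_empty (not_lt.2 (ht.trans h.le))]
    simp
  · refine ((measure_mono (Set.prod_mono ?_ Subset.rfl)).trans_lt (hX.finite s ⟨hs, h⟩)).ne
    exact fun r hr => ⟨hr.1.le, hr.2.trans ht⟩

theorem integrableOn_Ioc (hX : IsPathSolution κ T F x X η n) {s t : ℝ} (hs : 0 < s)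
    (ht : t ≤ T) : IntegrableOn (fun p : ℝ × ℝ => X p.1 p.2) (Ioc s t ×ˢ Icc 0 1) :=
  ((hX.continuousOn.mono (Set.prod_mono (fun _ hr => ⟨hs.trans_le hr.1, hr.2.trans ht⟩)
      Subset.rfl)).integrableOn_compact ((isCompact_Icc (a := s) (b := t)).prod
        isCompact_Icc)).mono_set (Set.prod_mono Ioc_subset_Icc_self Subset.rfl)

theorem integrableOn_nonlinearity (hX : IsPathSolution κ T F x X η n) {s t : ℝ} (hs : 0 < s)
    (ht : t ≤ T) : IntegrableOn (fun p : ℝ × ℝ => F (X p.1 p.2)) (Ioc s t ×ˢ Icc 0 1) :=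
  hX.integrable.mono_set
    (Set.prod_mono (fun _ hr => ⟨hs.le.trans hr.1.le, hr.2.trans ht⟩) Subset.rfl)

/-- Both solutions carry the same noise `n`, which disappears from the difference. -/
theorem cosIncrement (hX : IsPathSolution κ T F x X η n) (hY : IsPathSolution κ T F x Y ξ n)
    (hT : 0 < T) (k : ℕ) {q r : ℚ} (hq : 0 < q) (hqr : q ≤ r) (hr : r ≤ 1) :
    CosIncrement κ (fun t θ => X t θ - Y t θ) (fun p => F (X p.1 p.2) - F (Y p.1 p.2)) η ξ k
      (T * q) (T * r) := by
  have hq' := mul_rat_mem_Ioc hT hq (hqr.trans hr)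
  have hr' := mul_rat_mem_Ioc hT (hq.trans_le hqr) hr
  have eX := hX.equation k q r hq hqr hr
  have eY := hY.equation k q r hq hqr hr
  have hφ : ∀ {X : ℝ → ℝ → ℝ} {η : Measure (ℝ × ℝ)}, IsPathSolution κ T F x X η n →
      IntegrableOn (fun p : ℝ × ℝ => Real.cos (k * Real.pi * p.2) *
        (κ * (k * Real.pi) ^ 2 * F (X p.1 p.2) - κ * (k * Real.pi) ^ 4 * X p.1 p.2))
        (Ioc (T * (q : ℝ)) (T * r) ×ˢ Icc 0 1) := fun h =>
    integrableOn_cos_mul (((h.integrableOn_nonlinearity hq'.1 hr'.2).const_mul _).sub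
      ((h.integrableOn_Ioc hq'.1 hr'.2).const_mul _)) _
  have e : ∫ p in Ioc (T * (q : ℝ)) (T * r) ×ˢ Icc 0 1, Real.cos (k * Real.pi * p.2) *
      (κ * (k * Real.pi) ^ 2 * (F (X p.1 p.2) - F (Y p.1 p.2)) -
        κ * (k * Real.pi) ^ 4 * (X p.1 p.2 - Y p.1 p.2)) =
      (∫ p in Ioc (T * (q : ℝ)) (T * r) ×ˢ Icc 0 1, Real.cos (k * Real.pi * p.2) *
        (κ * (k * Real.pi) ^ 2 * F (X p.1 p.2) - κ * (k * Real.pi) ^ 4 * X p.1 p.2)) -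
      ∫ p in Ioc (T * (q : ℝ)) (T * r) ×ˢ Icc 0 1, Real.cos (k * Real.pi * p.2) *
        (κ * (k * Real.pi) ^ 2 * F (Y p.1 p.2) - κ * (k * Real.pi) ^ 4 * Y p.1 p.2) := by
    rw [← integral_sub (hφ hX) (hφ hY)]
    congr 1
    ext p
    ring
  rw [CosEquation] at eX eY
  rw [CosIncrement, e, integral_neg,
    cosIntegral_sub (continuousOn_section hX.continuousOn hr')
      (continuousOn_section hY.continuousOn hr'),
    cosIntegral_sub (continuousOn_section hX.continuousOn hq')
      (continuousOn_section hY.continuousOn hq')]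
  linarith

theorem ae_sub_mul_sub_nonpos (hF : AntitoneOn F (Ioi 0)) (hX : IsPathSolution κ T F x X η n)
    (hY : IsPathSolution κ T F x Y ξ n) :
    ∀ᵐ p : ℝ × ℝ ∂(volume.restrict (Icc 0 T ×ˢ Icc 0 1)),
      (X p.1 p.2 - Y p.1 p.2) * (F (X p.1 p.2) - F (Y p.1 p.2)) ≤ 0 := by
  filter_upwards [hX.pos, hY.pos] with p h1 h2
  rcases le_total (X p.1 p.2) (Y p.1 p.2) with h | h
  · exact mul_nonpos_of_nonpos_of_nonneg (sub_nonpos.2 h) (sub_nonneg.2 (hF h1 h2 h))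
  · exact mul_nonpos_of_nonneg_of_nonpos (sub_nonneg.2 h) (sub_nonpos.2 (hF h2 h1 h))

/-- On the contact set of `X`, which carries `η`, the difference is `-Y ≤ 0`. Exchanging the roles
of the solutions gives the sign for `ξ`. -/
theorem integral_sub_nonpos (hX : IsPathSolution κ T F x X η n)
    (hY : IsPathSolution κ T F x Y ξ n) {s t : ℝ} (hs : 0 < s) (ht : t ≤ T) :
    ∫ p in Ioc s t ×ˢ Icc 0 1, (X p.1 p.2 - Y p.1 p.2) ∂η ≤ 0 := by
  have hsub : Ioc s t ×ˢ Icc (0 : ℝ) 1 ⊆ Ioc 0 T ×ˢ Icc 0 1 :=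
    Set.prod_mono (Ioc_subset_Ioc hs.le ht) Subset.rfl
  refine integral_nonpos_of_ae ?_
  filter_upwards [ae_mono (Measure.restrict_mono_set _ hsub)
    (ae_eq_zero_of_contact hX.continuousOn hX.nonneg hX.contact),
    ae_restrict_mem (measurableSet_Ioc.prod measurableSet_Icc)] with p hp hpm
  have := hY.nonneg p.1 (hsub hpm).1 p.2 (hsub hpm).2
  simp only [Pi.zero_apply]
  linarith

/-- The energy bound is applied from `T r/(m + 2)` to `T r`. Its right-hand side is controlled by
the `V_{-1}` distances of both solutions to their common initial datum, which vanish as `m → ∞`. -/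
theorem cosIntegral_sub_eq_zero (hκ : 0 < κ) (hT : 0 < T) (hF : AntitoneOn F (Ioi 0))
    (hx : ContinuousOn x (Icc 0 1)) (hn : ∀ r : ℚ, 0 < r → r ≤ 1 → n 0 (T * r) = 0)
    (hX : IsPathSolution κ T F x X η n) (hY : IsPathSolution κ T F x Y ξ n) {r : ℚ} (hr0 : 0 < r)
    (hr1 : r ≤ 1) (k : ℕ) : cosIntegral k (fun θ => X (T * r) θ - Y (T * r) θ) = 0 := by
  have hr := mul_rat_mem_Ioc hT hr0 hr1
  have hz0 : ∀ t ∈ Ioc 0 T, cosIntegral 0 (fun θ => X t θ - Y t θ) = 0 := by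
    intro t ht
    rw [cosIntegral_sub (continuousOn_section hX.continuousOn ht)
      (continuousOn_section hY.continuousOn ht), hX.cosIntegral_zero_eq hT hx hn ht,
      hY.cosIntegral_zero_eq hT hx hn ht, sub_self]
  by_cases hk : k = 0
  · rw [hk]
    exact hz0 _ hr
  have hle : ∀ m : ℕ, ((k * Real.pi) ^ 2)⁻¹ *
      cosIntegral k (fun θ => X (T * r) θ - Y (T * r) θ) ^ 2 ≤
      2 * normVNegOne (fun θ => X (T * (r / (m + 2))) θ - X 0 θ) ^ 2 +
        2 * normVNegOne (fun θ => Y (T * (r / (m + 2))) θ - Y 0 θ) ^ 2 := by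
    intro m
    obtain ⟨hq0, hqr⟩ := div_pos_and_lt hr0 m
    set q : ℚ := r / (m + 2) with hq
    have hqm := mul_rat_mem_Ioc hT hq0 (hqr.le.trans hr1)
    have hqc : (q : ℝ) = r / (m + 2) := by rw [hq]; push_cast; rfl
    rw [← hqc]
    have hab : T * (q : ℝ) < T * r := by
      have : (q : ℝ) < r := by exact_mod_cast hqr
      gcongr
    have hsub : Icc (T * (q : ℝ)) (T * r) ⊆ Ioc 0 T := fun s hs =>
      ⟨hqm.1.trans_le hs.1, hs.2.trans hr.2⟩
    have hsub' : Ioc (T * (q : ℝ)) (T * r) ×ˢ Icc (0 : ℝ) 1 ⊆ Icc 0 T ×ˢ Icc 0 1 :=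
      Set.prod_mono (fun s hs => ⟨hqm.1.le.trans hs.1.le, hs.2.trans hr.2⟩) Subset.rfl
    refine inv_mul_cosIntegral_sq_le hκ hab (Z := fun t θ => X t θ - Y t θ)
      (F := fun p => F (X p.1 p.2) - F (Y p.1 p.2)) (η := η) (ξ := ξ)
      ((hX.continuousOn.sub hY.continuousOn).mono (Set.prod_mono hsub Subset.rfl))
      ((hX.integrableOn_nonlinearity hqm.1 hr.2).sub (hY.integrableOn_nonlinearity hqm.1 hr.2))
      (hX.measure_Ioc_ne_top hqm.1 hr.2) (hY.measure_Ioc_ne_top hqm.1 hr.2)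
      (fun t ht => hz0 t (hsub ht)) ?_ ?_ (integral_sub_nonpos hX hY hqm.1 hr.2) ?_ ?_ hk
    -- The nodes of an equal partition between rational multiples of `T` are again rational
    -- multiples of `T`, where the equation is available.
    · intro l _ i j hj
      have hi : (0 : ℚ) < i := by exact_mod_cast (Nat.zero_le j).trans_lt hj
      have hjq : (0 : ℚ) ≤ j / i := by positivity
      have hj1 : ((j + 1 : ℕ) : ℚ) / i ≤ 1 := (div_le_one hi).2 (by exact_mod_cast hj)
      have hjj : (j : ℚ) / i ≤ ((j + 1 : ℕ) : ℚ) / i := by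
        gcongr
        exact Nat.le_succ j
      have hd : 0 < r - q := sub_pos.2 hqr
      have := cosIncrement hX hY hT l (q := q + (r - q) * (j / i))
        (r := q + (r - q) * ((j + 1 : ℕ) / i)) (by positivity) (by gcongr)
        ((add_le_add_right (mul_le_of_le_one_right hd.le hj1) q).trans (by linarith))
      have e : ∀ y : ℚ, T * ((q + (r - q) * y : ℚ) : ℝ) = T * q + (T * r - T * q) * (y : ℝ) := by
        intro y
        push_cast
        ring
      rw [e, e] at this
      push_cast at this ⊢
      exact this
    · exact integral_nonpos_of_ae
        (ae_mono (Measure.restrict_mono_set _ hsub') (ae_sub_mul_sub_nonpos hF hX hY))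
    · have h := integral_sub_nonpos hY hX hqm.1 hr.2 (t := T * r)
      rw [← neg_nonneg, ← integral_neg] at h
      simpa using h
    · intro N
      have hcX := hX.continuousOn_apply hx (t := 0) ⟨le_rfl, hT.le⟩
      have hcY := hY.continuousOn_apply hx (t := 0) ⟨le_rfl, hT.le⟩
      have hcXq := continuousOn_section hX.continuousOn hqm
      have hcYq := continuousOn_section hY.continuousOn hqm
      refine le_trans ?_ (add_le_add
        (mul_le_mul_of_nonneg_left (sum_inv_mul_cosIntegral_sq_le (hcXq.sub hcX) N) zero_le_two)
        (mul_le_mul_of_nonneg_left (sum_inv_mul_cosIntegral_sq_le (hcYq.sub hcY) N) zero_le_two))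
      rw [Finset.mul_sum, Finset.mul_sum, ← Finset.sum_add_distrib]
      refine Finset.sum_le_sum fun l _ => ?_
      have e0 : cosIntegral l (X 0) = cosIntegral l (Y 0) := by
        rw [cosIntegral_congr hX.initial, cosIntegral_congr hY.initial]
      have e1 := cosIntegral_sub hcXq hcYq l
      have e2 := cosIntegral_sub hcXq hcX l
      have e3 := cosIntegral_sub hcYq hcY l
      rw [e1]
      change _ ≤ 2 * (_ * cosIntegral l (fun θ => X (T * q) θ - X 0 θ) ^ 2) +
        2 * (_ * cosIntegral l (fun θ => Y (T * q) θ - Y 0 θ) ^ 2)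
      rw [e2, e3, e0, mul_left_comm 2, mul_left_comm 2, ← mul_add]
      refine mul_le_mul_of_nonneg_left ?_ (by positivity)
      -- This is `(p - q)² ≤ 2p² + 2q²`, where `p` and `q` are the increments from the common
      -- initial coefficient.
      nlinarith [sq_nonneg ((cosIntegral l (X (T * q)) - cosIntegral l (Y 0)) +
        (cosIntegral l (Y (T * q)) - cosIntegral l (Y 0)))]
  have hr1' : (r : ℝ) ≤ 1 := by exact_mod_cast hr1
  have hr0' : (0 : ℝ) ≤ r := by exact_mod_cast hr0.le
  have hlim := (((hX.tendsto_normVNegOne hT hr1' hr0').pow 2).const_mul 2).add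
    (((hY.tendsto_normVNegOne hT hr1' hr0').pow 2).const_mul 2)
  have h0 := ge_of_tendsto' hlim hle
  have hkpos : 0 < ((k * Real.pi) ^ 2)⁻¹ := by
    have : (0 : ℝ) < k := by exact_mod_cast Nat.pos_of_ne_zero hk
    have := Real.pi_pos
    positivity
  have h1 : cosIntegral k (fun θ => X (T * r) θ - Y (T * r) θ) ^ 2 ≤ 0 :=
    nonpos_of_mul_nonpos_right (by simpa using h0) hkpos
  exact pow_eq_zero_iff two_ne_zero |>.1 (le_antisymm h1 (sq_nonneg _))

theorem unique (hκ : 0 < κ) (hT : 0 < T) (hF : AntitoneOn F (Ioi 0))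
    (hx : ContinuousOn x (Icc 0 1)) (hmean : 0 < mean x)
    (hn : ∀ r : ℚ, 0 < r → r ≤ 1 → n 0 (T * r) = 0)
    (hX : IsPathSolution κ T F x X η n) (hY : IsPathSolution κ T F x Y ξ n) :
    (∀ t ∈ Icc 0 T, ∀ θ ∈ Icc (0 : ℝ) 1, X t θ = Y t θ) ∧ η = ξ := by
  have hXY : ∀ t ∈ Ioc 0 T, ∀ θ ∈ Icc (0 : ℝ) 1, X t θ = Y t θ := by
    intro t ht θ hθ
    have hc : ContinuousOn (fun s => X s θ - Y s θ) (Ioc 0 T) :=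
      (hX.continuousOn.sub hY.continuousOn).comp (f := fun s => (s, θ)) (by fun_prop)
        fun s hs => ⟨hs, hθ⟩
    refine sub_eq_zero.1 (eq_of_eq_rat hT hc (fun r hr0 hr1 => ?_) ht)
    have hr := mul_rat_mem_Ioc hT hr0 hr1
    -- All coefficients vanish, so every Fejér mean is `0`, and so is the limit, which is the
    -- continuous difference itself.
    have hlim := tendsto_fejerSum ((continuousOn_section hX.continuousOn hr).sub
      (continuousOn_section hY.continuousOn hr)) hθ
    refine tendsto_nhds_unique hlim (tendsto_const_nhds.congr fun N => ?_)
    symm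
    refine Finset.sum_eq_zero fun k _ => ?_
    have := cosIntegral_sub_eq_zero hκ hT hF hx hn hX hY hr0 hr1 k
    change _ * cosIntegral k (fun θ => X (T * r) θ - Y (T * r) θ) * _ = 0
    rw [this]
    ring
  refine ⟨fun t ht θ hθ => ?_, ?_⟩
  · rcases ht.1.eq_or_lt with h | h
    · rw [← h, hX.initial θ hθ, hY.initial θ hθ]
    · exact hXY t ⟨h, ht.2⟩ θ hθ
  · refine measure_eq_of_cos hT hX.continuousOn
      (fun t ht => (hX.cosIntegral_zero_eq hT hx hn ht).symm ▸ hmean) hX.carrier hY.carrier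
      hX.finite hY.finite (ae_eq_zero_of_contact hX.continuousOn hX.nonneg hX.contact) ?_ ?_
    · filter_upwards [ae_eq_zero_of_contact hY.continuousOn hY.nonneg hY.contact,
        ae_restrict_mem (measurableSet_Ioc.prod measurableSet_Icc)] with p hp hpm
      rw [hXY p.1 hpm.1 p.2 hpm.2, hp]
    · intro q r hq hqr hr k hk
      have h := cosIncrement hX hY hT k hq hqr hr
      have hq' := mul_rat_mem_Ioc hT hq (hqr.trans hr)
      have hr' := mul_rat_mem_Ioc hT (hq.trans_le hqr) hr
      have hz : ∀ t ∈ Ioc 0 T, cosIntegral k (fun θ => X t θ - Y t θ) = 0 := by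
        intro t ht
        rw [cosIntegral_congr (h := fun _ => 0) (fun θ hθ => sub_eq_zero.2 (hXY t ht θ hθ))]
        simp [cosIntegral]
      have hv : ∫ p in Ioc (T * (q : ℝ)) (T * r) ×ˢ Icc 0 1, Real.cos (k * Real.pi * p.2) *
          (κ * (k * Real.pi) ^ 2 * (F (X p.1 p.2) - F (Y p.1 p.2)) -
            κ * (k * Real.pi) ^ 4 * (X p.1 p.2 - Y p.1 p.2)) = 0 := by
        refine setIntegral_eq_zero_of_forall_eq_zero fun p hp => ?_
        rw [hXY p.1 ⟨hq'.1.trans hp.1.1, hp.1.2.trans hr'.2⟩ p.2 hp.2]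
        ring
      rw [CosIncrement, hv, hz _ hq', hz _ hr', integral_neg, integral_const_mul,
        integral_const_mul] at h
      have hc : κ * (k * Real.pi) ^ 2 ≠ 0 := by
        have : (k : ℝ) ≠ 0 := by exact_mod_cast hk
        have := Real.pi_ne_zero
        positivity
      refine mul_left_cancel₀ hc ?_
      linarith

end IsPathSolution

/-! ### From weak solutions to paths -/

theorem IsAdmissibleNonlinearity.pos {f : ℝ → EReal} (hf : IsAdmissibleNonlinearity f) {y : ℝ}
    (hy : f y ≠ ⊤) : 0 < y := by
  by_contra h
  rcases hf with rfl | ⟨α, _, rfl⟩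
  · exact hy (if_neg h)
  · exact hy (if_neg h)

/-- Monotonicity is restricted to positive arguments because `toReal` sends `⊤` to `0`. This is
enough, since finiteness of `f(X)` forces `X > 0` almost everywhere. -/
theorem IsAdmissibleNonlinearity.antitoneOn {f : ℝ → EReal} (hf : IsAdmissibleNonlinearity f) :
    AntitoneOn (fun y => (f y).toReal) (Ioi 0) := by
  intro y (hy : 0 < y) z (hz : 0 < z) hyz
  rcases hf with rfl | ⟨α, hα, rfl⟩
  · simp only [fLog, if_pos hy, if_pos hz, EReal.toReal_coe]
    exact neg_le_neg (Real.log_le_log hy hyz)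
  · simp only [fPow, if_pos hy, if_pos hz, EReal.toReal_coe]
    exact Real.rpow_le_rpow_of_nonpos hy hyz (neg_nonpos.2 hα.le)

/-- The noise tested against the derivative of `cos (kπ·)`. -/
noncomputable def cosNoise {Ω : Type*} (W : ℝ → L2 → Ω → ℝ) (ω : Ω) (k : ℕ) (t : ℝ) : ℝ :=
  W t (isNeumannLaplacian_cos 1 k).derivL2 ω

theorem derivL2_cos_zero : (isNeumannLaplacian_cos 1 0).derivL2 = 0 := by
  refine (Lp.eq_zero_iff_ae_eq_zero (p := 2)).2 ((MemLp.coeFn_toLp _).trans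
    (Eventually.of_forall fun θ => ?_))
  simp

variable {Ω : Type*} [mΩ : MeasurableSpace Ω] {P : Measure Ω} {T : ℝ}

/-- The constant mode has zero derivative, and linearity with zero coefficients makes the noise
vanish there. This is what conserves mass. -/
theorem IsCylindricalWiener.ae_cosNoise_zero {𝓕 : Filtration (Icc (0 : ℝ) T) mΩ}
    {W : ℝ → L2 → Ω → ℝ} (hW : IsCylindricalWiener P T 𝓕 W) (hT : 0 < T) :
    ∀ᵐ ω ∂P, ∀ r : ℚ, 0 < r → r ≤ 1 → cosNoise W ω 0 (T * r) = 0 := by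
  refine ae_all_iff.2 fun r => ?_
  rw [eventually_imp_distrib_left]
  intro hr0
  rw [eventually_imp_distrib_left]
  intro hr1
  have hr := IsPathSolution.mul_rat_mem_Ioc hT hr0 hr1
  filter_upwards [hW.linear (T * r) ⟨hr.1.le, hr.2⟩ 0 0 0 0] with ω h
  rw [cosNoise, derivL2_cos_zero]
  simpa using h

theorem IsWeakSolution.ae_isPathSolution {κ : ℝ} {f : ℝ → EReal}
    (hf : IsAdmissibleNonlinearity f) (hT : 0 < T) {x : ℝ → ℝ}
    {𝓕 : Filtration (Icc (0 : ℝ) T) mΩ} {X : ℝ → ℝ → Ω → ℝ} {η : Ω → Measure (ℝ × ℝ)}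
    {W : ℝ → L2 → Ω → ℝ} (h : IsWeakSolution κ f T x P 𝓕 X η W) :
    ∀ᵐ ω ∂P, IsPathSolution κ T (fun y => (f y).toReal) x (fun t θ => X t θ ω) (η ω)
      (cosNoise W ω) := by
  -- The exceptional null set of the equation depends on the test function and the times.
  -- Restricting to countably many of them gives one null set for all.
  have heq : ∀ (k : ℕ) (q r : ℚ), ∀ᵐ ω ∂P, 0 < q → q ≤ r → r ≤ 1 → _ := fun k q r => by
    rw [eventually_imp_distrib_left]
    intro hq
    rw [eventually_imp_distrib_left]
    intro hqr
    rw [eventually_imp_distrib_left]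
    intro hr
    have hqr' : (q : ℝ) ≤ r := by exact_mod_cast hqr
    exact h.equation _ _ _ _ _ (isNeumannLaplacian_cos 1 k)
      (isNeumannLaplacian_cos (-(1 * (k * Real.pi) ^ 2)) k) (T * q) (T * r)
      (mul_pos hT (by exact_mod_cast hq)) (by gcongr)
      (mul_le_of_le_one_right hT.le (by exact_mod_cast hr))
  have heq' := ae_all_iff.2 fun k => ae_all_iff.2 fun q => ae_all_iff.2 fun r => heq k q r
  filter_upwards [h.continuousOn, h.nonneg, h.continuous_VNegOne, h.initial, h.carrier, h.finite,
    h.integrable, heq', h.contact] with ω h1 h2 h3 h4 h5 h6 h7 h8 h9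
  refine ⟨h1, h2, h3, h4, h5, h6, h7.1.mono fun p hp => hf.pos hp, h7.2, ?_, h9⟩
  intro k q r hq hqr hr
  -- The time `T q / 2` serves as common starting point; any positive rational multiple of `T` not
  -- after `T q` would do.
  have hq2 : q / 2 ≤ q := (half_lt_self hq).le
  have hδ := IsPathSolution.mul_rat_mem_Ioc hT (half_pos hq) (hq2.trans (hqr.trans hr))
  have hr' := IsPathSolution.mul_rat_mem_Ioc hT (hq.trans_le hqr) hr
  have hq2' : ((q / 2 : ℚ) : ℝ) ≤ q := by exact_mod_cast hq2
  have hqr' : (q : ℝ) ≤ r := by exact_mod_cast hqr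
  refine cosEquation_of_equation h1 h7.2 hδ.1 (s := T * q) (t := T * r) (by gcongr)
    (by gcongr) hr'.2 ?_ ?_
  · exact ((measure_mono (Set.prod_mono (Icc_subset_Icc_right hr'.2) Subset.rfl)).trans_lt
      (h6 _ hδ)).ne
  · rintro _ (rfl | rfl)
    · exact h8 k (q / 2) q (half_pos hq) hq2 (hqr.trans hr)
    · exact h8 k (q / 2) r (half_pos hq) (hq2.trans hqr) hr

end CahnHilliard

/-- Pathwise uniqueness for the reflected stochastic Cahn-Hilliard equation. The case `κ = 1/2` is the
equation `∂ₜX = -(1/2) Δ(ΔX + f(X) + η) + ∂_θ Ẇ`. -/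
theorem proposition3p1 {Ω : Type*} [mΩ : MeasurableSpace Ω]
    (P : MeasureTheory.Measure Ω) [MeasureTheory.IsProbabilityMeasure P]
    (κ : ℝ) (hκ : 0 < κ)
    (f : ℝ → EReal) (hf : CahnHilliard.IsAdmissibleNonlinearity f)
    (T : ℝ) (hT : 0 < T)
    (x : ℝ → ℝ) (hx_cont : ContinuousOn x (Set.Icc 0 1))
    (hx_nonneg : ∀ θ ∈ Set.Icc (0 : ℝ) 1, 0 ≤ x θ) (hx_mean : 0 < CahnHilliard.mean x)
    (𝓕₁ 𝓕₂ : MeasureTheory.Filtration (Set.Icc (0 : ℝ) T) mΩ)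
    (W : ℝ → CahnHilliard.L2 → Ω → ℝ)
    (X₁ X₂ : ℝ → ℝ → Ω → ℝ) (η₁ η₂ : Ω → MeasureTheory.Measure (ℝ × ℝ))
    (h₁ : CahnHilliard.IsWeakSolution κ f T x P 𝓕₁ X₁ η₁ W)
    (h₂ : CahnHilliard.IsWeakSolution κ f T x P 𝓕₂ X₂ η₂ W) :
    (∀ᵐ ω ∂P, ∀ t ∈ Set.Icc 0 T, ∀ θ ∈ Set.Icc (0 : ℝ) 1, X₁ t θ ω = X₂ t θ ω) ∧
    (∀ᵐ ω ∂P, η₁ ω = η₂ ω) := by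
  have h := (h₁.ae_isPathSolution hf hT).and
    ((h₂.ae_isPathSolution hf hT).and (h₁.wiener.ae_cosNoise_zero hT))
  refine ⟨h.mono fun ω hω => ?_, h.mono fun ω hω => ?_⟩
  · exact (CahnHilliard.IsPathSolution.unique hκ hT hf.antitoneOn hx_cont hx_mean hω.2.2 hω.1
      hω.2.1).1
  · exact (CahnHilliard.IsPathSolution.unique hκ hT hf.antitoneOn hx_cont hx_mean hω.2.2 hω.1
      hω.2.1).2
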